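/- **Consistency of the ML estimator in the ZIACD model.** Let $\theta=(\alpha,\pi,c,b,a)\in\mathbb{R}^5$ with $\alpha>0$ and $\pi\in[0,1)$. For $f\in\mathbb{R}$ let $\mathrm{P}[X=\cdot\mid f,\theta]$ be the zero-inflated negative binomial distribution with location $\mu=e^f$, i.e. $$\mathrm{P}[X=0\mid f,\theta]=\pi+(1-\pi)\Big(\frac{\alpha^{-1}}{\alpha^{-1}+e^f}\Big)^{\alpha^{-1}},$$ $$\mathrm{P}[X=x\mid f,\theta]=(1-\pi)\frac{\Gamma(x+\alpha^{-1})}{\Gamma(x+1)\Gamma(\alpha^{-1})}\Big(\frac{\alpha^{-1}}{\alpha^{-1}+e^f}\Big)^{\alpha^{-1}}\Big(\frac{e^f}{\alpha^{-1}+e^f}\Big)^{x},\quad x=1,2,\dots,$$ and let $s(x,f,\theta)=\nabla(x,f,\theta)=\partial\log \mathrm{P}[X=x\mid f,\theta]/\partial f$ be its score. Explicitly, $s(0,f,\theta)=\frac{(\pi-1)e^f}{(\alpha e^f+1)(1+\pi(\alpha e^f+1)^{1/\alpha}-\pi)}$ and $s(x,f,\theta)=\frac{x-e^f}{\alpha e^f+1}$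 for $x\ge 1$. Let $\Theta$ be a compact set of such parameters and let $\{x_i\}_{i\in\mathbb{Z}}$ be a strictly stationary and ergodic sequence of $\mathbb{N}_0$-valued random variables (not necessarily generated by the model). Let $\hat f_1(\theta)\in\mathbb{R}$ be an arbitrary initial value that is non-random and continuous in $\theta\in\Theta$ (for instance a constant), and let $\hat f_{i+1}(\theta)=c+b\hat f_i(\theta)+a\,s(x_i,\hat f_i(\theta),\theta)$ for $i\ge1$. Assume the invertibility conditions, where $\log 0=-\infty$ and expectations are taken in the extended sense: 1. $\log^+\sup_{\theta\in\Theta}|s(0,\hat f_1(\theta),\theta)|<\infty$; 2. $\mathrm{E}\big[\log^+\sup_{\theta\in\Theta}|s(x_i,\hat f_1(\theta),\theta)|\,\big|\,x_i>0\big]<\infty$; 3. $\mathrm{P}[x_i=0]\,\log R(0)+\mathrm{P}[x_i>0]\,\mathrm{E}[\log R(x_i)\mid x_i>0]<0$, where $R(x)=\sup_{f\in\mathbb{R}}\sup_{\theta\in\Theta}\big|a\,\frac{\partial s(x,f,\theta)}{\partial f}+b\big|$. For $i\in\mathbb{Z}$ let $f_i(\theta)$ denote the stationary limit filter, i.e.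 the almost sure limit, as $m\to\infty$, of the value at time $i$ of the same recursion started at time $i-m$ from $\hat f_1(\theta)$. Put $\ell_i(\theta)=\log\mathrm{P}[X_i=x_i\mid f_i(\theta),\theta]$. Assume that, for every $\theta\in\Theta$, $\mathrm{E}|\ell_i(\theta)|<\infty$ and $\mathrm{E}\big[\log^+\sup_{f\in\mathbb{R}}|\nabla(x_i,f,\theta)|\big]<\infty$. Finally suppose that $\theta_0\in\Theta$ is the unique maximizer of the limit log-likelihood over $\Theta$: $\mathrm{E}[\ell_i(\theta_0)]>\mathrm{E}[\ell_i(\theta)]$ for all $\theta\in\Theta$ with $\theta\ne\theta_0$. Let $\hat L_n(\theta)=\frac1n\sum_{i=1}^n\log\mathrm{P}[X_i=x_i\mid\hat f_i(\theta),\theta]$. If, for every $n\ge 1$, $\hat\theta_n\in\arg\max_{\theta\in\Theta}\hat L_n(\theta)$ almost surely, then $\hat\theta_n\to\theta_0$ almost surely as $n\to\infty$. -/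

import Mathlib

open MeasureTheory ProbabilityTheory Filter Topology
open scoped ENNReal

namespace ZIACD

/-- The static parameter vector `θ = (α, π, c, b, a)`, a point of `ℝ⁵`. -/
abbrev Param : Type := Fin 5 → ℝ

/-- The dispersion parameter `α`. -/
def Param.disp (θ : Param) : ℝ := θ 0

/-- The probability of excess zeros `π`. -/
def Param.infl (θ : Param) : ℝ := θ 1

/-- The constant `c` of the recursion. -/
def Param.const (θ : Param) : ℝ := θ 2

/-- The autoregressive parameter `b` of the recursion. -/
def Param.ar (θ : Param) : ℝ := θ 3

/-- The score parameter `a` of the recursion. -/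
def Param.sc (θ : Param) : ℝ := θ 4

/-- Probability mass at `x` of the negative binomial distribution with mean `m` and
dispersion `α`. -/
noncomputable def nbMass (α m : ℝ) (x : ℕ) : ℝ :=
  Real.Gamma (x + α⁻¹) / (Real.Gamma (x + 1) * Real.Gamma α⁻¹)
    * (α⁻¹ / (α⁻¹ + m)) ^ (α⁻¹) * (m / (α⁻¹ + m)) ^ x

/-- Probability mass `P[X = x | f, θ]` of the zero-inflated negative binomial distribution with
location `exp f`, dispersion `α` and excess-zero probability `π`. -/
noncomputable def mass (θ : Param) (x : ℕ) (f : ℝ) : ℝ :=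
  if x = 0 then
    θ.infl + (1 - θ.infl) * (θ.disp⁻¹ / (θ.disp⁻¹ + Real.exp f)) ^ (θ.disp⁻¹)
  else (1 - θ.infl) * nbMass θ.disp (Real.exp f) x

/-- Log-likelihood contribution `log P[X = x | f, θ]`. -/
noncomputable def logLik (θ : Param) (x : ℕ) (f : ℝ) : ℝ := Real.log (mass θ x f)

/-- The score `s(x, f) = ∇(x, f)` with unit scaling, with respect to `f = log μ`. -/
noncomputable def score (θ : Param) (x : ℕ) (f : ℝ) : ℝ :=
  if x = 0 then
    (θ.infl - 1) * Real.exp f /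
      ((θ.disp * Real.exp f + 1)
        * (1 + θ.infl * (θ.disp * Real.exp f + 1) ^ (θ.disp⁻¹) - θ.infl))
  else (x - Real.exp f) / (θ.disp * Real.exp f + 1)

/-- The score is the derivative of the log-likelihood contribution in `f`. -/
theorem hasDerivAt_logLik (θ : Param) (hα : 0 < θ.disp) (h0 : 0 ≤ θ.infl) (h1 : θ.infl < 1)
    (x : ℕ) (f : ℝ) : HasDerivAt (logLik θ x) (score θ x f) f := by
  have hE : 0 < Real.exp f := Real.exp_pos f
  have hβ : 0 < θ.disp⁻¹ := inv_pos.mpr hα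
  have hS : 0 < θ.disp⁻¹ + Real.exp f := by positivity
  have hD : 0 < θ.disp * Real.exp f + 1 := by positivity
  have hr : θ.disp⁻¹ / (θ.disp⁻¹ + Real.exp f) = (θ.disp * Real.exp f + 1)⁻¹ := by
    field_simp
    ring
  have hr0 : 0 < θ.disp⁻¹ / (θ.disp⁻¹ + Real.exp f) := by positivity
  have hden : HasDerivAt (fun g => θ.disp⁻¹ + Real.exp g) (Real.exp f) f :=
    (Real.hasDerivAt_exp f).const_add _
  have hq : HasDerivAt (fun g => θ.disp⁻¹ / (θ.disp⁻¹ + Real.exp g))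
      (-(θ.disp⁻¹ * Real.exp f) / (θ.disp⁻¹ + Real.exp f) ^ 2) f := by
    exact ((hasDerivAt_const f θ.disp⁻¹).div hden hS.ne').congr_deriv (by simp)
  have hqp := hq.rpow_const (p := θ.disp⁻¹) (Or.inl hr0.ne')
  have hP : 0 < (θ.disp⁻¹ / (θ.disp⁻¹ + Real.exp f)) ^ (θ.disp⁻¹) := Real.rpow_pos_of_pos hr0 _
  rw [Real.rpow_sub_one hr0.ne'] at hqp
  by_cases hx : x = 0
  · subst hx
    have hm : 0 < θ.infl
        + (1 - θ.infl) * (θ.disp⁻¹ / (θ.disp⁻¹ + Real.exp f)) ^ (θ.disp⁻¹) := by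
      have := mul_pos (sub_pos.mpr h1) hP
      linarith
    have key := ((hqp.const_mul (1 - θ.infl)).const_add θ.infl).log hm.ne'
    have hfun : logLik θ 0 = fun g => Real.log (θ.infl
        + (1 - θ.infl) * (θ.disp⁻¹ / (θ.disp⁻¹ + Real.exp g)) ^ (θ.disp⁻¹)) := by
      funext g; simp [logLik, mass]
    rw [hfun]
    refine HasDerivAt.congr_deriv key ?_
    rw [hr, Real.inv_rpow hD.le] at hm ⊢
    have hW : 0 < (θ.disp * Real.exp f + 1) ^ (θ.disp⁻¹) := Real.rpow_pos_of_pos hD _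
    have hs : θ.disp⁻¹ + Real.exp f = (θ.disp * Real.exp f + 1) / θ.disp := by
      field_simp
      ring
    rw [hs]
    simp only [score, if_true]
    set W := (θ.disp * Real.exp f + 1) ^ (θ.disp⁻¹)
    have hV : 0 < 1 + θ.infl * W - θ.infl := by
      have := mul_nonneg h0 hW.le
      linarith
    have hV' : θ.infl + (1 - θ.infl) * W⁻¹ = (1 + θ.infl * W - θ.infl) / W := by
      field_simp
      ring
    rw [hV']
    field_simp
    ring
  · have hp : HasDerivAt (fun g => Real.exp g / (θ.disp⁻¹ + Real.exp g))
        ((Real.exp f * (θ.disp⁻¹ + Real.exp f) - Real.exp f * Real.exp f)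
          / (θ.disp⁻¹ + Real.exp f) ^ 2) f := (Real.hasDerivAt_exp f).div hden hS.ne'
    have hp0 : 0 < Real.exp f / (θ.disp⁻¹ + Real.exp f) := by positivity
    have hC : 0 < Real.Gamma (x + θ.disp⁻¹) / (Real.Gamma (x + 1) * Real.Gamma θ.disp⁻¹) := by
      have a1 := Real.Gamma_pos_of_pos (show 0 < (x : ℝ) + θ.disp⁻¹ by positivity)
      have a2 := Real.Gamma_pos_of_pos (show 0 < (x : ℝ) + 1 by positivity)
      have a3 := Real.Gamma_pos_of_pos hβ
      positivity
    have hπ : 0 < 1 - θ.infl := sub_pos.mpr h1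
    have hfun : logLik θ x = fun g => Real.log (1 - θ.infl)
        + (Real.log (Real.Gamma (x + θ.disp⁻¹) / (Real.Gamma (x + 1) * Real.Gamma θ.disp⁻¹))
        + θ.disp⁻¹ * Real.log (θ.disp⁻¹ / (θ.disp⁻¹ + Real.exp g))
        + x * Real.log (Real.exp g / (θ.disp⁻¹ + Real.exp g))) := by
      funext g
      have b1 : 0 < θ.disp⁻¹ / (θ.disp⁻¹ + Real.exp g) := by positivity
      have b2 : 0 < Real.exp g / (θ.disp⁻¹ + Real.exp g) := by positivity
      have b3 := Real.rpow_pos_of_pos b1 θ.disp⁻¹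
      simp only [logLik, mass, if_neg hx, nbMass]
      rw [Real.log_mul hπ.ne' (by positivity), Real.log_mul (by positivity) (by positivity),
        Real.log_mul hC.ne' b3.ne', Real.log_rpow b1, Real.log_pow]
    rw [hfun]
    have key := ((((hq.log hr0.ne').const_mul θ.disp⁻¹).const_add
      (Real.log (Real.Gamma (x + θ.disp⁻¹) / (Real.Gamma (x + 1) * Real.Gamma θ.disp⁻¹)))).add
      ((hp.log hp0.ne').const_mul (x : ℝ))).const_add (Real.log (1 - θ.infl))
    refine HasDerivAt.congr_deriv key ?_
    have hs : θ.disp⁻¹ + Real.exp f = (θ.disp * Real.exp f + 1) / θ.disp := by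
      field_simp
      ring
    rw [hs]
    simp only [score, if_neg hx]
    field_simp
    ring

/-- One step `f ↦ c + b f + a s(x, f)` of the score recursion. -/
noncomputable def step (θ : Param) (x : ℕ) (f : ℝ) : ℝ :=
  θ.const + θ.ar * f + θ.sc * score θ x f

/-- The score recursion started at `f₀` and driven by the observations `y 0, y 1, …`:
`run θ y f₀ k` is its value after `k` steps. -/
noncomputable def run (θ : Param) (y : ℕ → ℕ) (f₀ : ℝ) : ℕ → ℝ
  | 0 => f₀
  | k + 1 => step θ (y k) (run θ y f₀ k)

/-- The filter `f̂ᵢ(θ)`, for `i = k + 1`, along the data path `x`: it starts at time `1` in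
the value `f₁ θ`. -/
noncomputable def filt (f₁ : Param → ℝ) (x : ℤ → ℕ) (k : ℕ) (θ : Param) : ℝ :=
  run θ (fun j => x (j + 1)) (f₁ θ) k

/-- The limit filter `fᵢ(θ)` along the data path `x`: the limit, as `m → ∞`, of the value at
time `i` of the recursion that is started at time `i - m`. -/
noncomputable def limitFilt (f₁ : Param → ℝ) (x : ℤ → ℕ) (i : ℤ) (θ : Param) : ℝ :=
  limUnder atTop (fun m : ℕ => run θ (fun j => x (i - m + j)) (f₁ θ) m)

/-- The sample log-likelihood `L̂ₙ(θ) = n⁻¹ ∑_{i=1}^n log P[Xᵢ = xᵢ | f̂ᵢ(θ), θ]`. -/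
noncomputable def sampleLogLik (f₁ : Param → ℝ) (x : ℤ → ℕ) (n : ℕ) (θ : Param) : ℝ :=
  (n : ℝ)⁻¹ * ∑ k ∈ Finset.range n, logLik θ (x (k + 1)) (filt f₁ x k θ)

/-- The log-likelihood contribution `ℓᵢ(θ) = log P[Xᵢ = xᵢ | fᵢ(θ), θ]` at the limit filter. -/
noncomputable def limitLogLik (f₁ : Param → ℝ) (x : ℤ → ℕ) (i : ℤ) (θ : Param) : ℝ :=
  logLik θ (x i) (limitFilt f₁ x i θ)

/-- `log⁺ y = max (log y) 0` for `y ∈ [0, ∞]`. -/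
noncomputable def logPos (y : ℝ≥0∞) : ℝ≥0∞ := (ENNReal.log y).toENNReal

/-- `log⁻ y = max (-log y) 0` for `y ∈ [0, ∞]`, so that `log⁻ 0 = ∞`. -/
noncomputable def logNeg (y : ℝ≥0∞) : ℝ≥0∞ := (-ENNReal.log y).toENNReal

/-- `sup_f sup_{θ ∈ Θ} |a ∂s(x, f, θ)/∂f + b|`, with values in `[0, ∞]`. -/
noncomputable def contraction (Θ : Set Param) (x : ℕ) : ℝ≥0∞ :=
  ⨆ f : ℝ, ⨆ θ ∈ Θ, ‖θ.sc * deriv (score θ x) f + θ.ar‖ₑ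

/-- A process indexed by `ℤ` is strictly stationary and ergodic: the shift preserves its law on
the path space and is ergodic for it. -/
def IsStationaryErgodic {Ω : Type*} [MeasurableSpace Ω] (μ : Measure Ω) (x : ℤ → Ω → ℕ) : Prop :=
  Ergodic (fun (y : ℤ → ℕ) i => y (i + 1)) (μ.map (fun ω i => x i ω))

/-- The invertibility conditions on the data `x`, the parameter set `Θ` and the
initialization `f₁`. -/
structure InvertibilityConditions {Ω : Type*} [MeasurableSpace Ω] (μ : Measure Ω)
    (x : ℤ → Ω → ℕ) (Θ : Set Param) (f₁ : Param → ℝ) : Prop where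
  stationary_ergodic : IsStationaryErgodic μ x
  compact : IsCompact Θ
  /-- `log⁺ sup_θ |s(0, f̂₁(θ), θ)| < ∞` -/
  zero_moment : logPos (⨆ θ ∈ Θ, ‖score θ 0 (f₁ θ)‖ₑ) < ∞
  /-- `E[log⁺ sup_θ |s(xᵢ, f̂₁(θ), θ)| | xᵢ > 0] < ∞` -/
  pos_moment :
    ∫⁻ ω, logPos (⨆ θ ∈ Θ, ‖score θ (x 1 ω) (f₁ θ)‖ₑ) ∂(μ[|{ω | 0 < x 1 ω}]) < ∞
  /-- `P[xᵢ = 0] log R(0) + P[xᵢ > 0] E[log R(xᵢ) | xᵢ > 0] < 0` for `R = contraction Θ`, in the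
  extended sense: the positive part of the left side is less than its negative part. -/
  contracting :
    μ {ω | x 1 ω = 0} * logPos (contraction Θ 0)
        + μ {ω | 0 < x 1 ω} *
          ∫⁻ ω, logPos (contraction Θ (x 1 ω)) ∂(μ[|{ω | 0 < x 1 ω}])
      < μ {ω | x 1 ω = 0} * logNeg (contraction Θ 0)
        + μ {ω | 0 < x 1 ω} *
          ∫⁻ ω, logNeg (contraction Θ (x 1 ω)) ∂(μ[|{ω | 0 < x 1 ω}])

end ZIACD

/-! Wald's consistency argument, carried out on the path space of the data. The score is bounded by
`x + α⁻¹` uniformly in `f` (`abs_score_le`), so the log-likelihood is Lipschitz in `f` with that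
constant. Since the score at `x ≥ 1` tends to `x` as `f → -∞`, the moment condition on the score
makes `log (1 + xᵢ)` integrable, and `1 + xᵢ` grows subexponentially along almost every path. By the
ergodic theorem, the contraction condition makes products of the factors `R(xᵢ)` decay
exponentially. Decay beats growth (`Ergodic.ae_summable_prod_mul_exp`), both into the past and into
the future. The past gives uniform convergence on `Θ` of the recursions started earlier and earlier,
hence a limit filter continuous in `θ` (`limitFilt_spec`). The future bounds the total gap between
the log-likelihood sums at the filter and at the limit filter, uniformly in `θ` and `n`
(`exists_abs_sum_logLik_sub_le`).

What remains is a stationary sum of `ℓᵢ(θ)`. Probabilities are at most `1`, so `ℓᵢ ≤ 0`, and a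
supremum of `ℓᵢ` over a ball about `θ` lies between `ℓᵢ(θ)` and `0`: it is integrable without
further moments. As the ball shrinks its mean tends to `E ℓᵢ(θ) < E ℓᵢ(θ₀)`
(`exists_ball_dominating_lt`), so by the ergodic theorem the whole ball eventually loses to `θ₀`.
Finitely many such balls cover `Θ` outside a neighbourhood of `θ₀`. -/

section Ergodic

/-! ### Pointwise ergodic theorem through running maxima. -/

variable {X : Type*}

/-- The running maximum `max (0, S₁, …, Sₙ)` of the Birkhoff sums of `g`. -/
noncomputable def birkhoffMax (T : X → X) (g : X → ℝ) : ℕ → X → ℝ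
  | 0 => fun _ => 0
  | n + 1 => fun x => max 0 (g x + birkhoffMax T g n (T x))

theorem birkhoffMax_nonneg (T : X → X) (g : X → ℝ) (n : ℕ) (x : X) : 0 ≤ birkhoffMax T g n x := by
  cases n <;> simp [birkhoffMax]

theorem birkhoffMax_le_succ (T : X → X) (g : X → ℝ) (n : ℕ) (x : X) :
    birkhoffMax T g n x ≤ birkhoffMax T g (n + 1) x := by
  induction n generalizing x with
  | zero => simp [birkhoffMax]
  | succ n ih =>
    have := ih (T x)
    simp only [birkhoffMax] at this ⊢
    gcongr

theorem birkhoffSum_le_birkhoffMax (T : X → X) (g : X → ℝ) (n : ℕ) (x : X) :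
    birkhoffSum T g n x ≤ birkhoffMax T g n x := by
  induction n generalizing x with
  | zero => simp [birkhoffMax]
  | succ n ih =>
    rw [birkhoffSum_succ']
    exact le_max_of_le_right (by gcongr; exact ih _)

theorem birkhoffMax_succ_le (T : X → X) (g : X → ℝ) (n : ℕ) (x : X) :
    birkhoffMax T g (n + 1) x ≤ |g x| + birkhoffMax T g n (T x) :=
  max_le (add_nonneg (abs_nonneg _) (birkhoffMax_nonneg T g n _))
    (by gcongr; exact le_abs_self _)

/-- The identity behind the maximal inequality: under a measure-preserving `T` and for integrable
`g` the left side has nonnegative integral, while the right side equals `g x` as soon as the maxima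
along the orbit of `T x` exceed `-g x`. -/
theorem birkhoffMax_succ_sub (T : X → X) (g : X → ℝ) (n : ℕ) (x : X) :
    birkhoffMax T g (n + 1) x - birkhoffMax T g n (T x) =
      max (-birkhoffMax T g n (T x)) (g x) := by
  simp only [birkhoffMax]
  rw [← max_sub_sub_right]
  simp

variable [MeasurableSpace X] {ν : Measure X} {T : X → X}

theorem measurable_birkhoffMax (hT : Measurable T) {g : X → ℝ} (hg : Measurable g) (n : ℕ) :
    Measurable (birkhoffMax T g n) := by
  induction n with
  | zero => exact measurable_const
  | succ n ih => exact measurable_const.max (hg.add (ih.comp hT))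

theorem integrable_birkhoffMax (hT : MeasurePreserving T ν ν) [IsFiniteMeasure ν] {g : X → ℝ}
    (hg : Integrable g ν) (n : ℕ) : Integrable (birkhoffMax T g n) ν := by
  induction n with
  | zero => exact integrable_const _
  | succ n ih =>
    exact (integrable_const (0 : ℝ)).sup (hg.add (hT.integrable_comp_of_integrable ih))

/-- If `g` has negative mean, then its Birkhoff sums are almost surely bounded above. -/
theorem Ergodic.ae_birkhoffSum_bddAbove (hT : Ergodic T ν) [IsFiniteMeasure ν] {g : X → ℝ}
    (hgm : Measurable g) (hg : Integrable g ν) (hneg : ∫ x, g x ∂ν < 0) :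
    ∀ᵐ x ∂ν, ∃ K : ℕ, ∀ n, birkhoffSum T g n x ≤ K := by
  set M := birkhoffMax T g
  have hM : ∀ n, Measurable (M n) := measurable_birkhoffMax hT.measurable hgm
  have hmono : ∀ x, Monotone fun n => M n x :=
    fun x => monotone_nat_of_le_succ fun n => birkhoffMax_le_succ T g n x
  -- The orbits with unbounded maxima. One step of `T` changes the maxima by an amount bounded
  -- independently of `n`, so this set is invariant.
  set A : Set X := {x | ∀ K : ℕ, ∃ n, (K : ℝ) ≤ M n x}
  have hA : MeasurableSet A := by
    have : A = ⋂ K : ℕ, ⋃ n, {x | (K : ℝ) ≤ M n x} := by ext; simp [A]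
    rw [this]
    exact .iInter fun K => .iUnion fun n => measurableSet_le measurable_const (hM n)
  have hinv : T ⁻¹' A = A := by
    ext x
    simp only [Set.mem_preimage, A, Set.mem_ofPred_eq]
    constructor
    · intro h K
      obtain ⟨L, hL⟩ := exists_nat_ge ((K : ℝ) - g x)
      obtain ⟨n, hn⟩ := h L
      exact ⟨n + 1, le_max_of_le_right (by linarith)⟩
    · intro h K
      obtain ⟨L, hL⟩ := exists_nat_ge ((K : ℝ) + |g x|)
      obtain ⟨n, hn⟩ := h L
      have h1 := birkhoffMax_le_succ T g n x
      have h2 := birkhoffMax_succ_le T g n x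
      exact ⟨n, by linarith⟩
  rcases hT.toPreErgodic.ae_mem_or_ae_notMem hA hinv with h | h
  -- If `A` had full measure, `∫ g` would be a limit of nonnegative integrals.
  · exfalso
    have hI : ∀ n, Integrable (M n) ν := integrable_birkhoffMax hT.toMeasurePreserving hg
    have hIT : ∀ n, Integrable (fun x => M n (T x)) ν :=
      fun n => hT.toMeasurePreserving.integrable_comp_of_integrable (hI n)
    have hpos : ∀ n, 0 ≤ ∫ x, max (-M n (T x)) (g x) ∂ν := by
      intro n
      have e : ∫ x, max (-M n (T x)) (g x) ∂ν = ∫ x, M (n + 1) x ∂ν - ∫ x, M n x ∂ν := by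
        have hc : ∫ x, M n x ∂ν = ∫ x, M n (T x) ∂ν := by
          conv_lhs => rw [← hT.map_eq]
          exact integral_map hT.measurable.aemeasurable (hM n).aestronglyMeasurable
        rw [hc, ← integral_sub (hI (n + 1)) (hIT n)]
        exact integral_congr_ae (ae_of_all _ fun x => (birkhoffMax_succ_sub T g n x).symm)
      rw [e, sub_nonneg]
      exact integral_mono (hI n) (hI (n + 1)) fun x => birkhoffMax_le_succ T g n x
    have hlim : Tendsto (fun n => ∫ x, max (-M n (T x)) (g x) ∂ν) atTop (𝓝 (∫ x, g x ∂ν)) := by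
      refine tendsto_integral_of_dominated_convergence (fun x => |g x|)
        (fun n => (((hM n).comp hT.measurable).neg.max hgm).aestronglyMeasurable) hg.abs
        (fun n => ae_of_all _ fun x => ?_) ?_
      · have := birkhoffMax_nonneg T g n (T x)
        rw [Real.norm_eq_abs, abs_le]
        exact ⟨(neg_abs_le _).trans (le_max_right _ _),
          max_le ((neg_nonpos.2 this).trans (abs_nonneg _)) (le_abs_self _)⟩
      · filter_upwards [h] with x hx
        have hx' : T x ∈ A := by rwa [← hinv] at hx
        obtain ⟨K, hK⟩ := exists_nat_ge (-g x)
        obtain ⟨n, hn⟩ := hx' K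
        refine tendsto_const_nhds.congr' ?_
        filter_upwards [eventually_ge_atTop n] with m hm
        have := hmono (T x) hm
        rw [max_eq_right]
        simp only at this
        linarith
    exact absurd (ge_of_tendsto' hlim hpos) hneg.not_ge
  · filter_upwards [h] with x hx
    simp only [A, Set.mem_ofPred_eq, not_forall, not_exists, not_le] at hx
    obtain ⟨K, hK⟩ := hx
    exact ⟨K, fun n => (birkhoffSum_le_birkhoffMax T g n x).trans (hK n).le⟩

/-- The upper half of the pointwise ergodic theorem. -/
theorem Ergodic.ae_eventually_birkhoffSum_le (hT : Ergodic T ν) [IsProbabilityMeasure ν]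
    {g : X → ℝ} (hgm : Measurable g) (hg : Integrable g ν) {c : ℝ} (hc : ∫ x, g x ∂ν < c) :
    ∀ᵐ x ∂ν, ∀ᶠ n : ℕ in atTop, birkhoffSum T g n x ≤ c * n := by
  obtain ⟨d, hd, hdc⟩ := exists_between hc
  have h := hT.ae_birkhoffSum_bddAbove (g := fun x => g x - d) (hgm.sub_const d)
    (hg.sub (integrable_const d))
    (by rw [integral_sub hg (integrable_const d)]; simpa using hd)
  filter_upwards [h] with x ⟨K, hK⟩
  obtain ⟨N, hN⟩ := exists_nat_ge ((K : ℝ) / (c - d))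
  filter_upwards [eventually_ge_atTop N] with n hn
  have h1 := hK n
  have h2 : birkhoffSum T (fun x => g x - d) n x = birkhoffSum T g n x - d * n := by
    simp [birkhoffSum, Finset.sum_sub_distrib, mul_comm]
  have h3 : (K : ℝ) ≤ (c - d) * n := by
    rw [div_le_iff₀' (sub_pos.2 hdc)] at hN
    exact hN.trans (by have : (N : ℝ) ≤ n := by exact_mod_cast hn
                       have := sub_pos.2 hdc
                       gcongr)
  linarith

/-- The lower half of the pointwise ergodic theorem. -/
theorem Ergodic.ae_eventually_le_birkhoffSum (hT : Ergodic T ν) [IsProbabilityMeasure ν]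
    {g : X → ℝ} (hgm : Measurable g) (hg : Integrable g ν) {c : ℝ} (hc : c < ∫ x, g x ∂ν) :
    ∀ᵐ x ∂ν, ∀ᶠ n : ℕ in atTop, c * n ≤ birkhoffSum T g n x := by
  have h := hT.ae_eventually_birkhoffSum_le (g := fun x => -g x) (c := -c) hgm.neg hg.neg
    (by rw [integral_neg]; linarith)
  filter_upwards [h] with x hx
  filter_upwards [hx] with n hn
  simp only [birkhoffSum, Finset.sum_neg_distrib] at hn ⊢
  linarith

/-- An integrable function grows sublinearly along almost every orbit. -/
theorem Ergodic.ae_eventually_iterate_le (hT : Ergodic T ν) [IsProbabilityMeasure ν]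
    {w : X → ℝ} (hwm : Measurable w) (hw : Integrable w ν) {ε : ℝ} (hε : 0 < ε) :
    ∀ᵐ x ∂ν, ∀ᶠ n : ℕ in atTop, w (T^[n] x) ≤ ε * n := by
  set I := ∫ x, w x ∂ν
  filter_upwards [hT.ae_eventually_birkhoffSum_le hwm hw (c := I + ε / 4) (by linarith),
    hT.ae_eventually_le_birkhoffSum hwm hw (c := I - ε / 4) (by linarith)] with x h1 h2
  -- As a difference of consecutive Birkhoff sums, `w (T^[n] x)` is at most `(ε / 2) n + (I + ε /
  -- 4)`; `N` absorbs the constant.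
  obtain ⟨N, hN⟩ := exists_nat_ge ((I + ε / 4) / (ε / 2))
  filter_upwards [(tendsto_add_atTop_nat 1).eventually h1, h2, eventually_ge_atTop N]
    with n hn1 hn2 hn
  rw [birkhoffSum_succ] at hn1
  rw [div_le_iff₀ (by linarith)] at hN
  have : (N : ℝ) ≤ n := by exact_mod_cast hn
  push_cast at hn1
  nlinarith

end Ergodic

/-! ### Bounds and regularity of the mass function and the score. -/

namespace ZIACD

/-- The admissible static parameters. -/
def admissible : Set Param := {θ | 0 < θ.disp ∧ 0 ≤ θ.infl ∧ θ.infl < 1}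

theorem nbMass_pos {α m : ℝ} (hα : 0 < α) (hm : 0 < m) (x : ℕ) : 0 < nbMass α m x := by
  have hβ := inv_pos.2 hα
  have h1 := Real.Gamma_pos_of_pos (show 0 < (x : ℝ) + α⁻¹ by positivity)
  have h2 := Real.Gamma_pos_of_pos (show 0 < (x : ℝ) + 1 by positivity)
  have h3 := Real.Gamma_pos_of_pos hβ
  unfold nbMass
  positivity

/-- A negative binomial probability is at most `1`: the distribution is a Poisson mixture. -/
theorem nbMass_le_one {α m : ℝ} (hα : 0 < α) (hm : 0 < m) (x : ℕ) : nbMass α m x ≤ 1 := by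
  have hr : 0 < α⁻¹ := inv_pos.2 hα
  unfold nbMass
  set r := α⁻¹
  have hG := Real.Gamma_pos_of_pos hr
  have hfac : (0 : ℝ) < x.factorial := by positivity
  set q := m / (r + m) with hq
  have hq0 : 0 < q := by positivity
  have hp : r / (r + m) = 1 - q := by rw [hq]; field_simp; ring
  have hp0 : 0 < 1 - q := by rw [← hp]; positivity
  rw [hp, Real.Gamma_nat_eq_factorial]
  have e1 := Real.integral_rpow_mul_exp_neg_mul_Ioi (a := x + r) (r := 1) (by positivity) one_pos
  have e2 := Real.integral_rpow_mul_exp_neg_mul_Ioi (a := r) (r := 1 - q) hr hp0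
  have i1 : IntegrableOn (fun t : ℝ => t ^ ((x : ℝ) + r - 1) * Real.exp (-(1 * t)))
      (Set.Ioi 0) := by
    refine .of_integral_ne_zero ?_
    rw [e1]
    have := Real.Gamma_pos_of_pos (show 0 < (x : ℝ) + r by positivity)
    positivity
  have i2 : IntegrableOn (fun t : ℝ => t ^ (r - 1) * Real.exp (-((1 - q) * t)))
      (Set.Ioi 0) := by
    refine .of_integral_ne_zero ?_
    rw [e2]
    positivity
  -- One term of the exponential series, `(q t)^x / x! ≤ exp (q t)`, integrated against `t^(r-1) exp
  -- (-t)`.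
  have key : q ^ x / x.factorial * Real.Gamma (x + r) ≤ (1 / (1 - q)) ^ r * Real.Gamma r := by
    have e1' : Real.Gamma (x + r) =
        ∫ t : ℝ in Set.Ioi 0, t ^ ((x : ℝ) + r - 1) * Real.exp (-(1 * t)) := by
      rw [e1]; simp
    rw [e1', ← e2, ← integral_const_mul]
    refine setIntegral_mono_on (i1.const_mul _) i2 measurableSet_Ioi fun t ht => ?_
    have ht : 0 < t := ht
    have h1 : (q * t) ^ x / x.factorial ≤ Real.exp (q * t) :=
      Real.pow_div_factorial_le_exp (q * t) (by positivity) x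
    have h2 : t ^ ((x : ℝ) + r - 1) = t ^ x * t ^ (r - 1) := by
      rw [add_sub_assoc, Real.rpow_add ht, Real.rpow_natCast]
    have h3 : Real.exp (-((1 - q) * t)) = Real.exp (q * t) * Real.exp (-(1 * t)) := by
      rw [← Real.exp_add]; ring_nf
    rw [h2, h3]
    calc q ^ x / x.factorial * (t ^ x * t ^ (r - 1) * Real.exp (-(1 * t)))
        = (q * t) ^ x / x.factorial * (t ^ (r - 1) * Real.exp (-(1 * t))) := by
          rw [mul_pow]; ring
      _ ≤ Real.exp (q * t) * (t ^ (r - 1) * Real.exp (-(1 * t))) := by gcongr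
      _ = _ := by ring
  have hpr : (0 : ℝ) < (1 - q) ^ r := by positivity
  calc Real.Gamma (x + r) / (x.factorial * Real.Gamma r) * (1 - q) ^ r * q ^ x
      = (q ^ x / x.factorial * Real.Gamma (x + r)) * ((1 - q) ^ r / Real.Gamma r) := by
        field_simp
    _ ≤ (1 / (1 - q)) ^ r * Real.Gamma r * ((1 - q) ^ r / Real.Gamma r) := by gcongr
    _ = 1 := by
        rw [Real.div_rpow one_pos.le hp0.le, Real.one_rpow]
        field_simp

theorem mass_pos {θ : Param} (hθ : θ ∈ admissible) (x : ℕ) (f : ℝ) : 0 < mass θ x f := by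
  obtain ⟨hα, h0, h1⟩ := hθ
  have hE := Real.exp_pos f
  have h1' := sub_pos.2 h1
  unfold mass
  split_ifs
  · positivity
  · exact mul_pos h1' (nbMass_pos hα hE x)

theorem mass_le_one {θ : Param} (hθ : θ ∈ admissible) (x : ℕ) (f : ℝ) : mass θ x f ≤ 1 := by
  obtain ⟨hα, h0, h1⟩ := hθ
  have hE := Real.exp_pos f
  have h1' := sub_pos.2 h1
  unfold mass
  split_ifs
  · have : (θ.disp⁻¹ / (θ.disp⁻¹ + Real.exp f)) ^ (θ.disp⁻¹) ≤ 1 :=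
      Real.rpow_le_one (by positivity) (div_le_one_of_le₀ (by linarith) (by positivity))
        (by positivity)
    nlinarith
  · have := nbMass_le_one hα hE x
    have := nbMass_pos hα hE x
    nlinarith

/-- This sign is what makes local suprema of the log-likelihood integrable as soon as one value is.
-/
theorem logLik_nonpos {θ : Param} (hθ : θ ∈ admissible) (x : ℕ) (f : ℝ) : logLik θ x f ≤ 0 :=
  Real.log_nonpos (mass_pos hθ x f).le (mass_le_one hθ x f)

/-- Both cases rest on `e^f / (α e^f + 1) ≤ α⁻¹`; at `x = 0` the remaining factor is at most `1`
because `(α e^f + 1)^(1/α) ≥ 1`. -/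
theorem abs_score_le {θ : Param} (hθ : θ ∈ admissible) (x : ℕ) (f : ℝ) :
    |score θ x f| ≤ x + θ.disp⁻¹ := by
  obtain ⟨hα, h0, h1⟩ := hθ
  have hE := Real.exp_pos f
  have hD : 0 < θ.disp * Real.exp f + 1 := by positivity
  have hq : Real.exp f / (θ.disp * Real.exp f + 1) ≤ θ.disp⁻¹ := by
    rw [div_le_iff₀ hD]
    field_simp
    linarith
  unfold score
  split_ifs with hx
  · subst hx
    have hW : 1 ≤ (θ.disp * Real.exp f + 1) ^ (θ.disp⁻¹) :=
      Real.one_le_rpow (by nlinarith) (by positivity)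
    set W := (θ.disp * Real.exp f + 1) ^ (θ.disp⁻¹)
    have hV : 1 ≤ 1 + θ.infl * W - θ.infl := by nlinarith
    rw [abs_div, abs_mul, abs_mul, abs_of_pos hE, abs_of_pos hD,
      abs_of_pos (one_pos.trans_le hV), abs_of_neg (sub_neg.2 h1)]
    calc _ ≤ 1 * Real.exp f / ((θ.disp * Real.exp f + 1) * 1) := by
          gcongr; linarith
      _ ≤ _ := by simpa using hq
  · rw [sub_div]
    have h1 : (x : ℝ) / (θ.disp * Real.exp f + 1) ≤ x :=
      div_le_self (by positivity) (by nlinarith)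
    have h2 : 0 ≤ (x : ℝ) / (θ.disp * Real.exp f + 1) := by positivity
    have h3 : 0 ≤ Real.exp f / (θ.disp * Real.exp f + 1) := by positivity
    have h4 : (0 : ℝ) ≤ x := by positivity
    rw [abs_le]
    constructor <;> linarith

theorem abs_logLik_sub_le {θ : Param} (hθ : θ ∈ admissible) (x : ℕ) (f g : ℝ) :
    |logLik θ x f - logLik θ x g| ≤ (x + θ.disp⁻¹) * |f - g| :=
  convex_univ.norm_image_sub_le_of_norm_hasDerivWithin_le
    (fun y _ => (hasDerivAt_logLik θ hθ.1 hθ.2.1 hθ.2.2 x y).hasDerivWithinAt)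
    (fun y _ => abs_score_le hθ x y) (Set.mem_univ g) (Set.mem_univ f)

theorem differentiable_score {θ : Param} (hθ : θ ∈ admissible) (x : ℕ) :
    Differentiable ℝ (score θ x) := by
  obtain ⟨hα, h0, h1⟩ := hθ
  intro f
  have hD : ∀ f, 0 < θ.disp * Real.exp f + 1 := fun f => by positivity
  by_cases hx : x = 0
  · have : score θ x = fun f => (θ.infl - 1) * Real.exp f /
      ((θ.disp * Real.exp f + 1)
        * (1 + θ.infl * (θ.disp * Real.exp f + 1) ^ (θ.disp⁻¹) - θ.infl)) := by
      funext f; simp [score, hx]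
    rw [this]
    have hW : 0 < (θ.disp * Real.exp f + 1) ^ (θ.disp⁻¹) := Real.rpow_pos_of_pos (hD f) _
    have hV : 0 < 1 + θ.infl * (θ.disp * Real.exp f + 1) ^ (θ.disp⁻¹) - θ.infl := by
      have := mul_nonneg h0 hW.le
      linarith
    refine DifferentiableAt.div (by fun_prop) ?_ (mul_pos (hD f) hV).ne'
    refine DifferentiableAt.mul (by fun_prop) ?_
    refine DifferentiableAt.sub_const (DifferentiableAt.const_add _
      (DifferentiableAt.const_mul ?_ _)) _
    exact DifferentiableAt.rpow_const (by fun_prop) (Or.inl (hD f).ne')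
  · have : score θ x = fun f => (x - Real.exp f) / (θ.disp * Real.exp f + 1) := by
      funext f; simp [score, hx]
    rw [this]
    exact DifferentiableAt.div (by fun_prop) (by fun_prop) (hD f).ne'

/-- Mean value inequality. Finiteness matters: `toReal` would turn an infinite factor into `0`. -/
theorem abs_step_sub_le {Θ : Set Param} {θ : Param} (hθ : θ ∈ admissible) (hΘ : θ ∈ Θ) (x : ℕ)
    (hR : contraction Θ x ≠ ∞) (f g : ℝ) :
    |step θ x f - step θ x g| ≤ (contraction Θ x).toReal * |f - g| := by
  refine convex_univ.norm_image_sub_le_of_norm_hasDerivWithin_le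
    (f' := fun y => θ.ar + θ.sc * deriv (score θ x) y)
    (fun y _ => HasDerivAt.hasDerivWithinAt ?_) (fun y _ => ?_) (Set.mem_univ g) (Set.mem_univ f)
  · unfold step
    have h1 := (differentiable_score hθ x y).hasDerivAt.const_mul θ.sc
    have h2 := (((hasDerivAt_id y).const_mul θ.ar).const_add θ.const).add h1
    exact h2.congr_deriv (by simp)
  · have : ‖θ.sc * deriv (score θ x) y + θ.ar‖ₑ ≤ contraction Θ x :=
      (le_iSup₂ (f := fun θ (_ : θ ∈ Θ) => ‖θ.sc * deriv (score θ x) y + θ.ar‖ₑ) θ hΘ).trans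
        (le_iSup (fun y => ⨆ θ ∈ Θ, ‖θ.sc * deriv (score θ x) y + θ.ar‖ₑ) y)
    have h := ENNReal.toReal_mono hR this
    rw [toReal_enorm, add_comm] at h
    exact h

@[fun_prop]
theorem continuous_disp : Continuous Param.disp := continuous_apply 0
@[fun_prop]
theorem continuous_infl : Continuous Param.infl := continuous_apply 1
@[fun_prop]
theorem continuous_const : Continuous Param.const := continuous_apply 2
@[fun_prop]
theorem continuous_ar : Continuous Param.ar := continuous_apply 3
@[fun_prop]
theorem continuous_sc : Continuous Param.sc := continuous_apply 4

theorem continuousAt_score {p : Param × ℝ} (hp : p.1 ∈ admissible) (x : ℕ) :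
    ContinuousAt (fun p : Param × ℝ => score p.1 x p.2) p := by
  obtain ⟨hα, h0, h1⟩ := hp
  have hD : 0 < p.1.disp * Real.exp p.2 + 1 := by positivity
  by_cases hx : x = 0
  · simp only [score, hx, if_true]
    have hW : 0 < (p.1.disp * Real.exp p.2 + 1) ^ (p.1.disp⁻¹) := Real.rpow_pos_of_pos hD _
    have hV : 0 < 1 + p.1.infl * (p.1.disp * Real.exp p.2 + 1) ^ (p.1.disp⁻¹) - p.1.infl := by
      have := mul_nonneg h0 hW.le
      linarith
    have hr : ContinuousAt (fun p : Param × ℝ =>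
        (p.1.disp * Real.exp p.2 + 1) ^ (p.1.disp⁻¹)) p :=
      ContinuousAt.rpow (by fun_prop) (ContinuousAt.inv₀ (by fun_prop) hα.ne') (Or.inl hD.ne')
    exact ContinuousAt.div (by fun_prop) (by fun_prop) (mul_pos hD hV).ne'
  · simp only [score, hx, if_false]
    exact ContinuousAt.div (by fun_prop) (by fun_prop) hD.ne'

theorem continuousAt_logLik {p : Param × ℝ} (hp : p.1 ∈ admissible) (x : ℕ) :
    ContinuousAt (fun p : Param × ℝ => logLik p.1 x p.2) p := by
  refine ContinuousAt.log ?_ (mass_pos hp x p.2).ne'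
  obtain ⟨hα, h0, h1⟩ := hp
  have hβ := inv_pos.2 hα
  have hinv : ContinuousAt (fun p : Param × ℝ => p.1.disp⁻¹) p :=
    ContinuousAt.inv₀ (by fun_prop) hα.ne'
  have hS : p.1.disp⁻¹ + Real.exp p.2 ≠ 0 := by positivity
  have hr : ContinuousAt (fun p : Param × ℝ =>
      (p.1.disp⁻¹ / (p.1.disp⁻¹ + Real.exp p.2)) ^ (p.1.disp⁻¹)) p :=
    ContinuousAt.rpow (ContinuousAt.div (by fun_prop) (by fun_prop) hS) hinv
      (Or.inl (by positivity))
  by_cases hx : x = 0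
  · simp only [mass, hx, if_true]
    fun_prop
  · simp only [mass, hx, if_false, nbMass]
    have hΓ : ∀ y : ℝ, 0 < y → ContinuousAt Real.Gamma y := fun y hy =>
      (Real.differentiableAt_Gamma fun m => by
        have : (0 : ℝ) ≤ m := m.cast_nonneg
        linarith).continuousAt
    have g1 : ContinuousAt (fun p : Param × ℝ => Real.Gamma (x + p.1.disp⁻¹)) p :=
      (hΓ _ (by positivity)).comp (f := fun p : Param × ℝ => x + p.1.disp⁻¹) (by fun_prop)
    have g2 : ContinuousAt (fun p : Param × ℝ => Real.Gamma (p.1.disp⁻¹)) p :=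
      (hΓ _ hβ).comp (f := fun p : Param × ℝ => p.1.disp⁻¹) hinv
    have n1 := (Real.Gamma_pos_of_pos (show (0 : ℝ) < x + 1 by positivity)).ne'
    have n2 := (Real.Gamma_pos_of_pos hβ).ne'
    have g3 : ContinuousAt (fun p : Param × ℝ => Real.Gamma (x + p.1.disp⁻¹) /
        (Real.Gamma (x + 1) * Real.Gamma p.1.disp⁻¹)) p :=
      ContinuousAt.div g1 (by fun_prop) (mul_ne_zero n1 n2)
    have g4 : ContinuousAt (fun p : Param × ℝ =>
        Real.exp p.2 / (p.1.disp⁻¹ + Real.exp p.2)) p :=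
      ContinuousAt.div (by fun_prop) (by fun_prop) hS
    fun_prop

end ZIACD

/-! ### Exponential decay of random products. -/

/-- If `log r` has negative mean and `w` is integrable, then `r(x) ⋯ r(Sⁿ⁻¹ x) exp w(Sⁿ x)` is
summable along almost every orbit. -/
theorem Ergodic.ae_summable_prod_mul_exp {X : Type*} [MeasurableSpace X] {ν : Measure X}
    [IsProbabilityMeasure ν] {S : X → X} (hS : Ergodic S ν) {r h w : X → ℝ} (hr0 : ∀ x, 0 ≤ r x)
    (hrh : ∀ x, r x ≤ Real.exp (h x)) (hhm : Measurable h) (hh : Integrable h ν)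
    (hneg : ∫ x, h x ∂ν < 0) (hwm : Measurable w) (hw : Integrable w ν) :
    ∀ᵐ x ∂ν, Summable fun n : ℕ =>
      (∏ j ∈ Finset.range n, r (S^[j] x)) * Real.exp (w (S^[n] x)) := by
  set I := ∫ x, h x ∂ν
  -- The product is at most `exp (n I / 2)` and the weight at most `exp (-n I / 4)`, which leaves a
  -- geometric series of ratio `exp (I / 4) < 1`.
  filter_upwards [hS.ae_eventually_birkhoffSum_le hhm hh (c := I / 2) (by linarith),
    hS.ae_eventually_iterate_le hwm hw (ε := -I / 4) (by linarith)] with x h1 h2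
  have hgeo : Summable fun n : ℕ => Real.exp (I / 4) ^ n :=
    summable_geometric_of_lt_one (Real.exp_pos _).le (by rw [Real.exp_lt_one_iff]; linarith)
  refine Summable.of_norm_bounded_eventually_nat hgeo ?_
  filter_upwards [h1, h2] with n hn1 hn2
  have hp : ∏ j ∈ Finset.range n, r (S^[j] x) ≤ Real.exp (birkhoffSum S h n x) := by
    rw [birkhoffSum, Real.exp_sum]
    exact Finset.prod_le_prod (fun j _ => hr0 _) fun j _ => hrh _
  rw [Real.norm_of_nonneg (mul_nonneg (Finset.prod_nonneg fun j _ => hr0 _) (Real.exp_pos _).le),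
    ← Real.exp_nat_mul]
  calc _ ≤ Real.exp (birkhoffSum S h n x) * Real.exp (w (S^[n] x)) := by gcongr
    _ = Real.exp (birkhoffSum S h n x + w (S^[n] x)) := (Real.exp_add _ _).symm
    _ ≤ _ := by gcongr; linarith

/-! ### Extended logarithms and moments. -/

namespace ZIACD

theorem logPos_eq_top_iff {y : ℝ≥0∞} : logPos y = ∞ ↔ y = ∞ := by
  rw [logPos, EReal.toENNReal_eq_top_iff, ENNReal.log_eq_top_iff]

theorem logPos_mono {y z : ℝ≥0∞} (h : y ≤ z) : logPos y ≤ logPos z :=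
  EReal.toENNReal_le_toENNReal (ENNReal.log_monotone h)

theorem logPos_ofReal {r : ℝ} (hr : 0 < r) :
    logPos (ENNReal.ofReal r) = ENNReal.ofReal (Real.log r) := by
  rw [logPos, ENNReal.log_ofReal_of_pos hr, EReal.real_coe_toENNReal]

/-- The score at `x` is unbounded in `x` as `f → -∞`. -/
theorem natCast_le_iSup_score {θ : Param} (x : ℕ) :
    (x : ℝ≥0∞) ≤ ⨆ f : ℝ, ‖score θ x f‖ₑ := by
  rcases Nat.eq_zero_or_pos x with rfl | hx
  · simp
  have hx0 : x ≠ 0 := hx.ne'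
  have h1 : Tendsto (fun f => score θ x f) atBot (𝓝 (x : ℝ)) := by
    simp only [score, if_neg hx0]
    have he := Real.tendsto_exp_atBot
    have := (he.const_sub (x : ℝ)).div ((he.const_mul θ.disp).add_const 1) (by simp)
    simp only [mul_zero, zero_add, sub_zero, div_one] at this
    exact this
  have h2 := (continuous_enorm.tendsto _).comp h1
  have h3 : ‖(x : ℝ)‖ₑ = (x : ℝ≥0∞) := by
    rw [Real.enorm_of_nonneg (by positivity), ENNReal.ofReal_natCast]
  rw [← h3]
  exact le_of_tendsto' h2 fun f => le_iSup (fun f => ‖score θ x f‖ₑ) f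

section Moments

variable {Ω : Type*} [MeasurableSpace Ω] {μ : Measure Ω} [IsProbabilityMeasure μ] {X : Ω → ℕ}

/-- For `n ≥ 1`, `log (1 + n) ≤ log 2 + log n`, and `n` is at most the supremum of the score over
`f`. -/
theorem integrable_log_one_add (hX : Measurable X) {θ : Param}
    (h : ∫⁻ ω, logPos (⨆ f : ℝ, ‖score θ (X ω) f‖ₑ) ∂μ < ∞) :
    Integrable (fun ω => Real.log (1 + X ω)) μ := by
  have hm : Measurable fun ω => Real.log (1 + X ω) :=
    (measurable_from_top (f := fun n : ℕ => Real.log (1 + n))).comp hX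
  refine ⟨hm.aestronglyMeasurable, ?_⟩
  have hle : ∀ n : ℕ, ‖Real.log (1 + n)‖ₑ ≤
      ENNReal.ofReal (Real.log 2) + logPos (⨆ f : ℝ, ‖score θ n f‖ₑ) := by
    intro n
    have h0 : 0 ≤ Real.log (1 + n) := Real.log_nonneg (by simp)
    rw [Real.enorm_of_nonneg h0]
    rcases Nat.eq_zero_or_pos n with rfl | hn
    · simp
    have hn' : (1 : ℝ) ≤ n := by exact_mod_cast hn
    calc ENNReal.ofReal (Real.log (1 + n))
        ≤ ENNReal.ofReal (Real.log 2 + Real.log n) := by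
          rw [← Real.log_mul two_ne_zero (by positivity)]
          gcongr
          linarith
      _ ≤ ENNReal.ofReal (Real.log 2) + ENNReal.ofReal (Real.log n) := ENNReal.ofReal_add_le
      _ ≤ _ := by
          rw [← logPos_ofReal (r := (n : ℝ)) (by positivity), ENNReal.ofReal_natCast]
          gcongr
          exact logPos_mono (natCast_le_iSup_score n)
  refine (lintegral_mono fun ω => hle (X ω)).trans_lt ?_
  rw [lintegral_add_left measurable_const]
  simp [h]

/-- Law of total expectation; if `X > 0` has probability zero, both of its contributions vanish. -/
theorem measure_zero_mul_add_measure_pos_mul (hX : Measurable X) (F : ℕ → ℝ≥0∞) :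
    μ {ω | X ω = 0} * F 0 + μ {ω | 0 < X ω} * ∫⁻ ω, F (X ω) ∂(μ[|{ω | 0 < X ω}]) =
      ∫⁻ ω, F (X ω) ∂μ := by
  have hs : MeasurableSet {ω | X ω = 0} := hX (measurableSet_singleton 0)
  have hc : {ω | X ω = 0}ᶜ = {ω | 0 < X ω} := by ext; simp [Nat.pos_iff_ne_zero]
  have hpos : MeasurableSet {ω | 0 < X ω} := hc ▸ hs.compl
  rw [← lintegral_add_compl (μ := μ) (fun ω => F (X ω)) hs, hc]
  congr 1
  · rw [setLIntegral_congr_fun (g := fun _ => F 0) hs fun ω hω => by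
      simp only [Set.mem_ofPred_eq] at hω; simp [hω]]
    simp [mul_comm]
  · rw [ProbabilityTheory.cond, lintegral_smul_measure, smul_eq_mul, ← mul_assoc]
    by_cases h0 : μ {ω | 0 < X ω} = 0
    · rw [Measure.restrict_eq_zero.2 h0]
      simp
    · rw [ENNReal.mul_inv_cancel h0 (measure_ne_top _ _), one_mul]

/-- A random variable whose extended logarithm has negative mean, possibly `-∞`, is dominated by the
exponential of an integrable one of negative mean. -/
theorem exists_integrable_log_bound (hX : Measurable X) (R : ℕ → ℝ≥0∞)
    (h : ∫⁻ ω, logPos (R (X ω)) ∂μ < ∫⁻ ω, logNeg (R (X ω)) ∂μ) :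
    ∃ g : ℕ → ℝ, Integrable (fun ω => g (X ω)) μ ∧ ∫ ω, g (X ω) ∂μ < 0 ∧
      ∀ n, (R n).toReal ≤ Real.exp (g n) := by
  have hmeas : ∀ F : ℕ → ℝ≥0∞, Measurable fun ω => F (X ω) :=
    fun F => measurable_from_top.comp hX
  -- `log⁻` may have infinite mean. Truncated at a large `M` it is integrable and, by monotone
  -- convergence, still outweighs `log⁺`.
  have hlim : Tendsto (fun M : ℕ => ∫⁻ ω, min (logNeg (R (X ω))) M ∂μ) atTop
      (𝓝 (∫⁻ ω, logNeg (R (X ω)) ∂μ)) := by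
    refine lintegral_tendsto_of_tendsto_of_monotone
      (fun M => (hmeas fun n => min (logNeg (R n)) M).aemeasurable)
      (ae_of_all _ fun ω M N hMN => by dsimp only; gcongr) (ae_of_all _ fun ω => ?_)
    simpa using (tendsto_const_nhds (x := logNeg (R (X ω)))).min ENNReal.tendsto_nat_nhds_top
  obtain ⟨M, hM⟩ := ((tendsto_order.1 hlim).1 _ h).exists
  have hfin : ∫⁻ ω, min (logNeg (R (X ω))) M ∂μ ≠ ∞ := by
    refine ne_top_of_le_ne_top (b := (M : ℝ≥0∞)) (ENNReal.natCast_ne_top M) ?_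
    calc _ ≤ ∫⁻ _, (M : ℝ≥0∞) ∂μ := lintegral_mono fun ω => min_le_right _ _
      _ = M := by simp
  have hpm := hmeas fun n => logPos (R n)
  have hnm := hmeas fun n => min (logNeg (R n)) M
  have i1 := integrable_toReal_of_lintegral_ne_top hpm.aemeasurable h.ne_top
  have i2 := integrable_toReal_of_lintegral_ne_top hnm.aemeasurable hfin
  refine ⟨fun n => (logPos (R n)).toReal - (min (logNeg (R n)) M).toReal, i1.sub i2, ?_, ?_⟩
  · rw [integral_sub i1 i2,
      integral_toReal hpm.aemeasurable (ae_lt_top hpm h.ne_top),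
      integral_toReal hnm.aemeasurable (ae_lt_top hnm hfin), sub_neg]
    exact ENNReal.toReal_strict_mono hfin hM
  · intro n
    by_cases h0 : R n = 0
    · rw [h0]; exact (Real.exp_pos _).le
    by_cases htop : R n = ∞
    · rw [htop]; exact (Real.exp_pos _).le
    have hpos : 0 < (R n).toReal := ENNReal.toReal_pos h0 htop
    have e1 : (logPos (R n)).toReal = max (Real.log (R n).toReal) 0 := by
      rw [logPos, ENNReal.log_pos_real h0 htop, EReal.real_coe_toENNReal, ENNReal.toReal_ofReal']
    have e2 : logNeg (R n) = ENNReal.ofReal (-Real.log (R n).toReal) := by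
      rw [logNeg, ENNReal.log_pos_real h0 htop, ← EReal.coe_neg, EReal.real_coe_toENNReal]
    have e3 : (min (logNeg (R n)) M).toReal ≤ max (-Real.log (R n).toReal) 0 := by
      rw [← ENNReal.toReal_ofReal', ← e2]
      exact ENNReal.toReal_mono (e2 ▸ ENNReal.ofReal_ne_top) (min_le_left _ _)
    rw [← Real.log_le_iff_le_exp hpos]
    dsimp only
    rw [e1]
    have e4 := max_zero_sub_max_neg_zero_eq_self (Real.log (R n).toReal)
    linarith

end Moments

end ZIACD

/-! ### The score recursion and its stationary limit. -/

namespace ZIACD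

theorem run_succ' (θ : Param) (y : ℕ → ℕ) (f : ℝ) (n : ℕ) :
    run θ y f (n + 1) = run θ (fun j => y (j + 1)) (step θ (y 0) f) n := by
  induction n with
  | zero => rfl
  | succ n ih => rw [run, ih, run]

theorem continuousOn_run {Θ : Set Param} (hΘ : Θ ⊆ admissible) {f₁ : Param → ℝ}
    (hf₁ : ContinuousOn f₁ Θ) (y : ℕ → ℕ) (n : ℕ) :
    ContinuousOn (fun θ => run θ y (f₁ θ) n) Θ := by
  induction n with
  | zero => exact hf₁
  | succ n ih =>
    intro θ hθ
    have hs : ContinuousWithinAt (fun θ => score θ (y n) (run θ y (f₁ θ) n)) Θ θ :=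
      (continuousAt_score (p := (θ, run θ y (f₁ θ) n)) (hΘ hθ) (y n)).comp_continuousWithinAt
        (f := fun θ => (θ, run θ y (f₁ θ) n)) (continuousWithinAt_id.prodMk (ih θ hθ))
    have hr := ih θ hθ
    simp only [run, step]
    exact ((continuous_const.continuousWithinAt).add
      ((continuous_ar.continuousWithinAt).mul hr)).add
      ((continuous_sc.continuousWithinAt).mul hs)

theorem abs_run_sub_le {Θ : Set Param} {θ : Param} (hθ : θ ∈ admissible) (hΘ : θ ∈ Θ)
    {y : ℕ → ℕ} (hR : ∀ j, contraction Θ (y j) ≠ ∞) (f g : ℝ) (n : ℕ) :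
    |run θ y f n - run θ y g n| ≤
      (∏ j ∈ Finset.range n, (contraction Θ (y j)).toReal) * |f - g| := by
  induction n with
  | zero => simp [run]
  | succ n ih =>
    calc _ ≤ (contraction Θ (y n)).toReal * |run θ y f n - run θ y g n| :=
          abs_step_sub_le hθ hΘ (y n) (hR n) _ _
      _ ≤ (contraction Θ (y n)).toReal *
          ((∏ j ∈ Finset.range n, (contraction Θ (y j)).toReal) * |f - g|) := by gcongr
      _ = _ := by rw [Finset.prod_range_succ]; ring

theorem exists_inv_disp_le {Θ : Set Param} (hΘ : Θ ⊆ admissible) (hc : IsCompact Θ) :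
    ∃ K : ℝ, 0 ≤ K ∧ ∀ θ ∈ Θ, θ.disp⁻¹ ≤ K := by
  obtain ⟨K, hK⟩ := hc.exists_bound_of_continuousOn (f := fun θ : Param => θ.disp⁻¹)
    (continuous_disp.continuousOn.inv₀ fun θ hθ => (hΘ hθ).1.ne')
  exact ⟨max K 0, le_max_right _ _,
    fun θ hθ => (le_abs_self _).trans ((hK θ hθ).trans (le_max_left _ _))⟩

/-- Compactness bounds the coefficients and `abs_score_le` gives the linear growth in `x`. This is
the price of starting the recursion one step earlier. -/
theorem exists_abs_step_sub_le {Θ : Set Param} (hΘ : Θ ⊆ admissible) (hc : IsCompact Θ)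
    {f₁ : Param → ℝ} (hf₁ : ContinuousOn f₁ Θ) :
    ∃ C : ℝ, ∀ θ ∈ Θ, ∀ x : ℕ, |step θ x (f₁ θ) - f₁ θ| ≤ C * (1 + x) := by
  obtain ⟨K, hK0, hK⟩ := exists_inv_disp_le hΘ hc
  obtain ⟨A, hA⟩ := hc.exists_bound_of_continuousOn
    (f := fun θ : Param => θ.const + θ.ar * f₁ θ - f₁ θ)
    (((continuous_const.continuousOn).add (continuous_ar.continuousOn.mul hf₁)).sub hf₁)
  obtain ⟨B, hB⟩ := hc.exists_bound_of_continuousOn (f := Param.sc) continuous_sc.continuousOn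
  refine ⟨A + B * (1 + K), fun θ hθ x => ?_⟩
  have hA' : |θ.const + θ.ar * f₁ θ - f₁ θ| ≤ A := hA θ hθ
  have hB' : |θ.sc| ≤ B := hB θ hθ
  have hs := abs_score_le (hΘ hθ) x (f₁ θ)
  have hd := hK θ hθ
  have hx : (0 : ℝ) ≤ x := x.cast_nonneg
  have hA0 := (abs_nonneg _).trans hA'
  have hB0 := (abs_nonneg _).trans hB'
  calc |step θ x (f₁ θ) - f₁ θ|
      = |(θ.const + θ.ar * f₁ θ - f₁ θ) + θ.sc * score θ x (f₁ θ)| := by unfold step; ring_nf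
    _ ≤ A + B * (x + K) := by
        refine (abs_add_le _ _).trans ?_
        rw [abs_mul]
        have : |score θ x (f₁ θ)| ≤ x + K := by linarith
        gcongr
    _ ≤ (A + B * (1 + K)) * (1 + x) := by
        nlinarith [mul_nonneg hA0 hx, mul_nonneg hB0 hx, mul_nonneg (mul_nonneg hB0 hK0) hx]

/-- The recursion started at time `i - m` in `f₁ θ`, evaluated at time `i`. -/
noncomputable def pastRun (f₁ : Param → ℝ) (y : ℤ → ℕ) (i : ℤ) (m : ℕ) (θ : Param) : ℝ :=
  run θ (fun j => y (i - m + j)) (f₁ θ) m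

/-- The product of the contraction factors at the times `i - m, …, i - 1`, weighted by
the observation at time `i - m - 1`. -/
noncomputable def pastFactor (Θ : Set Param) (y : ℤ → ℕ) (i : ℤ) (m : ℕ) : ℝ :=
  (∏ j ∈ Finset.range m, (contraction Θ (y (i - 1 - j))).toReal) * (1 + y (i - 1 - m))

theorem dist_pastRun_succ_le {Θ : Set Param} {θ : Param} (hθ : θ ∈ admissible) (hΘ : θ ∈ Θ)
    {y : ℤ → ℕ} (hR : ∀ j, contraction Θ (y j) ≠ ∞) {f₁ : Param → ℝ} {C : ℝ}
    (hC : ∀ x : ℕ, |step θ x (f₁ θ) - f₁ θ| ≤ C * (1 + x)) (i : ℤ) (m : ℕ) :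
    dist (pastRun f₁ y i m θ) (pastRun f₁ y i (m + 1) θ) ≤ C * pastFactor Θ y i m := by
  -- Starting one step earlier amounts to starting at time `i - m` from a different value.
  have e1 : pastRun f₁ y i (m + 1) θ =
      run θ (fun j => y (i - m + j)) (step θ (y (i - 1 - m)) (f₁ θ)) m := by
    rw [pastRun, run_succ']
    congr 2
    · funext j; congr 1; push_cast; ring
    · congr 1; push_cast; ring
  have e2 : ∏ j ∈ Finset.range m, (contraction Θ (y (i - m + j))).toReal =
      ∏ j ∈ Finset.range m, (contraction Θ (y (i - 1 - j))).toReal := by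
    rw [← Finset.prod_range_reflect]
    refine Finset.prod_congr rfl fun j hj => ?_
    have := Finset.mem_range.1 hj
    congr 3
    omega
  rw [dist_comm, Real.dist_eq, e1, pastRun]
  refine (abs_run_sub_le hθ hΘ (fun j => hR _) _ _ m).trans ?_
  rw [e2, pastFactor]
  calc _ ≤ (∏ j ∈ Finset.range m, (contraction Θ (y (i - 1 - j))).toReal) *
        (C * (1 + (y (i - 1 - m) : ℕ))) :=
        mul_le_mul_of_nonneg_left (hC _) (Finset.prod_nonneg fun _ _ => ENNReal.toReal_nonneg)
    _ = _ := by ring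

/-- The limit filter is the uniform limit of the recursions started in the past. -/
theorem limitFilt_spec {Θ : Set Param} (hΘ : Θ ⊆ admissible) (hc : IsCompact Θ)
    {f₁ : Param → ℝ} (hf₁ : ContinuousOn f₁ Θ) {y : ℤ → ℕ} (hR : ∀ j, contraction Θ (y j) ≠ ∞)
    {i : ℤ} (hs : Summable (pastFactor Θ y i)) :
    (∀ θ ∈ Θ, Tendsto (fun m => pastRun f₁ y i m θ) atTop (𝓝 (limitFilt f₁ y i θ))) ∧
      (∃ D, ∀ θ ∈ Θ, |f₁ θ - limitFilt f₁ y i θ| ≤ D) ∧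
      ContinuousOn (limitFilt f₁ y i) Θ := by
  obtain ⟨C, hC⟩ := exists_abs_step_sub_le hΘ hc hf₁
  set d : ℕ → ℝ := fun m => C * pastFactor Θ y i m
  have hd : Summable d := hs.mul_left C
  have hdist : ∀ θ ∈ Θ, ∀ m, dist (pastRun f₁ y i m θ) (pastRun f₁ y i (m + 1) θ) ≤ d m :=
    fun θ hθ m => dist_pastRun_succ_le (hΘ hθ) hθ hR (hC θ hθ) i m
  -- Summable increments make the sequence Cauchy, so `limUnder` is a true limit and not a default
  -- value.
  have hlim : ∀ θ ∈ Θ, Tendsto (fun m => pastRun f₁ y i m θ) atTop (𝓝 (limitFilt f₁ y i θ)) :=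
    fun θ hθ => (cauchySeq_of_dist_le_of_summable d (hdist θ hθ) hd).tendsto_limUnder
  have htail : ∀ θ ∈ Θ, ∀ m,
      dist (pastRun f₁ y i m θ) (limitFilt f₁ y i θ) ≤ ∑' k, d (m + k) :=
    fun θ hθ m => dist_le_tsum_of_dist_le_of_tendsto d (hdist θ hθ) hd (hlim θ hθ) m
  refine ⟨hlim, ⟨∑' k, d (0 + k), fun θ hθ => htail θ hθ 0⟩, ?_⟩
  have hunif : TendstoUniformlyOn (pastRun f₁ y i) (limitFilt f₁ y i) atTop Θ := by
    rw [Metric.tendstoUniformlyOn_iff]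
    intro ε hε
    have h0 : Tendsto (fun m => ∑' k, d (m + k)) atTop (𝓝 0) := by
      simpa only [add_comm] using tendsto_sum_nat_add d
    filter_upwards [(tendsto_order.1 h0).2 ε hε] with m hm θ hθ
    rw [dist_comm]
    exact (htail θ hθ m).trans_lt hm
  exact hunif.continuousOn (Frequently.of_forall fun m => continuousOn_run hΘ hf₁ _ m)

/-- The run of `m + 1` steps ending at `i + 1` extends the run of `m` steps ending at `i`; let `m →
∞` and use continuity of the step. -/
theorem limitFilt_add_one {θ : Param} (hθ : θ ∈ admissible) {f₁ : Param → ℝ} {y : ℤ → ℕ} {i : ℤ}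
    (hlim : Tendsto (fun m => pastRun f₁ y i m θ) atTop (𝓝 (limitFilt f₁ y i θ))) :
    limitFilt f₁ y (i + 1) θ = step θ (y i) (limitFilt f₁ y i θ) := by
  refine Tendsto.limUnder_eq ?_
  rw [← tendsto_add_atTop_iff_nat 1]
  have hstep : Continuous (step θ (y i)) := by
    unfold step
    have := (differentiable_score hθ (y i)).continuous
    fun_prop
  refine ((hstep.tendsto _).comp hlim).congr fun m => ?_
  simp only [Function.comp, pastRun, run]
  congr 1
  · congr 1; push_cast; ring
  · congr 1; funext j; congr 1; push_cast; ring

/-- The limit filter obeys the same recursion, so the two differ only in their value at time `1`,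
and that gap contracts. -/
theorem abs_filt_sub_limitFilt_le {Θ : Set Param} {θ : Param} (hθ : θ ∈ admissible) (hΘ : θ ∈ Θ)
    {f₁ : Param → ℝ} {y : ℤ → ℕ} (hR : ∀ j, contraction Θ (y j) ≠ ∞)
    (hlim : ∀ k : ℕ, Tendsto (fun m => pastRun f₁ y (k + 1) m θ) atTop
      (𝓝 (limitFilt f₁ y (k + 1) θ))) (k : ℕ) :
    |filt f₁ y k θ - limitFilt f₁ y (k + 1) θ| ≤
      (∏ j ∈ Finset.range k, (contraction Θ (y (j + 1))).toReal) *
        |f₁ θ - limitFilt f₁ y 1 θ| := by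
  have hrun : ∀ k : ℕ, limitFilt f₁ y (k + 1) θ =
      run θ (fun j => y (j + 1)) (limitFilt f₁ y 1 θ) k := by
    intro k
    induction k with
    | zero => simp [run]
    | succ k ih =>
      rw [run, ← ih, ← limitFilt_add_one hθ (hlim k)]
      push_cast
      rfl
  rw [hrun k]
  exact abs_run_sub_le hθ hΘ (fun j => hR _) _ _ k

/-- The sample log-likelihood at the filter and the one at the limit filter differ by `O(1/n)`,
uniformly over `Θ`. -/
theorem exists_abs_sum_logLik_sub_le {Θ : Set Param} (hΘ : Θ ⊆ admissible) (hc : IsCompact Θ)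
    {f₁ : Param → ℝ} (hf₁ : ContinuousOn f₁ Θ) {y : ℤ → ℕ} (hR : ∀ j, contraction Θ (y j) ≠ ∞)
    (hpast : ∀ k : ℕ, Summable (pastFactor Θ y (k + 1)))
    (hfut : Summable fun k : ℕ =>
      (∏ j ∈ Finset.range k, (contraction Θ (y (j + 1))).toReal) * (1 + (y (k + 1) : ℝ))) :
    ∃ E : ℝ, ∀ θ ∈ Θ, ∀ n : ℕ,
      |∑ k ∈ Finset.range n, logLik θ (y (k + 1)) (filt f₁ y k θ) -
        ∑ k ∈ Finset.range n, limitLogLik f₁ y (k + 1) θ| ≤ E := by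
  obtain ⟨K, hK0, hK⟩ := exists_inv_disp_le hΘ hc
  have hspec := fun k : ℕ => limitFilt_spec hΘ hc hf₁ hR (hpast k)
  obtain ⟨D, hD⟩ := (hspec 0).2.1
  set F : ℕ → ℝ := fun k =>
    (∏ j ∈ Finset.range k, (contraction Θ (y (j + 1))).toReal) * (1 + (y (k + 1) : ℝ))
  refine ⟨(1 + K) * |D| * ∑' k, F k, fun θ hθ n => ?_⟩
  have hP : ∀ k, 0 ≤ ∏ j ∈ Finset.range k, (contraction Θ (y (j + 1))).toReal :=
    fun k => Finset.prod_nonneg fun _ _ => ENNReal.toReal_nonneg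
  have hF : ∀ k, 0 ≤ F k := fun k => mul_nonneg (hP k) (by positivity)
  have hD' : |f₁ θ - limitFilt f₁ y 1 θ| ≤ |D| := by
    have := hD θ hθ
    simp only [Nat.cast_zero, zero_add] at this
    exact this.trans (le_abs_self D)
  -- Lipschitz constant times contracted initial gap; the Lipschitz constant is the reason for the
  -- weight `1 + x`.
  have hterm : ∀ k : ℕ, |logLik θ (y (k + 1)) (filt f₁ y k θ) - limitLogLik f₁ y (k + 1) θ| ≤
      (1 + K) * |D| * F k := by
    intro k
    have h1 := abs_filt_sub_limitFilt_le (hΘ hθ) hθ hR (fun k => (hspec k).1 θ hθ) k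
    have h2 : (y (k + 1) : ℝ) + θ.disp⁻¹ ≤ (1 + K) * (1 + y (k + 1)) := by
      have := hK θ hθ
      nlinarith [mul_nonneg hK0 (Nat.cast_nonneg (α := ℝ) (y (k + 1)))]
    calc _ ≤ ((y (k + 1) : ℝ) + θ.disp⁻¹) * |filt f₁ y k θ - limitFilt f₁ y (k + 1) θ| :=
          abs_logLik_sub_le (hΘ hθ) _ _ _
      _ ≤ ((1 + K) * (1 + y (k + 1))) *
          ((∏ j ∈ Finset.range k, (contraction Θ (y (j + 1))).toReal) * |D|) := by
          gcongr
          exact h1.trans (mul_le_mul_of_nonneg_left hD' (hP k))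
      _ = _ := by simp only [F]; ring
  rw [← Finset.sum_sub_distrib]
  calc _ ≤ ∑ k ∈ Finset.range n, (1 + K) * |D| * F k :=
        (Finset.abs_sum_le_sum_abs _ _).trans (Finset.sum_le_sum fun k _ => hterm k)
    _ = (1 + K) * |D| * ∑ k ∈ Finset.range n, F k := by rw [Finset.mul_sum]
    _ ≤ _ := by
        have := hfut.sum_le_tsum (Finset.range n) fun k _ => hF k
        gcongr

theorem continuousOn_limitLogLik {Θ : Set Param} (hΘ : Θ ⊆ admissible) {f₁ : Param → ℝ}
    {y : ℤ → ℕ} {i : ℤ} (h : ContinuousOn (limitFilt f₁ y i) Θ) :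
    ContinuousOn (limitLogLik f₁ y i) Θ := fun θ hθ =>
  (continuousAt_logLik (p := (θ, limitFilt f₁ y i θ)) (hΘ hθ) (y i)).comp_continuousWithinAt
    (f := fun θ => (θ, limitFilt f₁ y i θ)) (continuousWithinAt_id.prodMk (h θ hθ))

end ZIACD

/-! ### Shift, measurability and stable paths. -/

namespace ZIACD

/-- The shift of the path space, as a measurable equivalence. -/
def shift : (ℤ → ℕ) ≃ᵐ (ℤ → ℕ) where
  toFun y i := y (i + 1)
  invFun y i := y (i - 1)
  left_inv y := by funext i; simp
  right_inv y := by funext i; simp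
  measurable_toFun := measurable_pi_lambda _ fun i => measurable_pi_apply (i + 1)
  measurable_invFun := measurable_pi_lambda _ fun i => measurable_pi_apply (i - 1)

theorem shift_apply (y : ℤ → ℕ) (i : ℤ) : shift y i = y (i + 1) := rfl

theorem shift_symm_apply (y : ℤ → ℕ) (i : ℤ) : shift.symm y i = y (i - 1) := rfl

theorem shift_iterate_apply (k : ℕ) (y : ℤ → ℕ) (i : ℤ) : shift^[k] y i = y (i + k) := by
  induction k generalizing i with
  | zero => simp
  | succ k ih => rw [Function.iterate_succ_apply', shift_apply, ih]; push_cast; ring_nf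

theorem shift_symm_iterate_apply (k : ℕ) (y : ℤ → ℕ) (i : ℤ) :
    shift.symm^[k] y i = y (i - k) := by
  induction k generalizing i with
  | zero => simp
  | succ k ih => rw [Function.iterate_succ_apply', shift_symm_apply, ih]; push_cast; ring_nf

theorem limitFilt_iterate_shift (f₁ : Param → ℝ) (y : ℤ → ℕ) (k : ℕ) (θ : Param) :
    limitFilt f₁ (shift^[k] y) 1 θ = limitFilt f₁ y (k + 1) θ := by
  simp only [limitFilt, shift_iterate_apply]
  congr 1
  funext m
  congr 1
  funext j
  congr 1
  ring

theorem limitLogLik_iterate_shift (f₁ : Param → ℝ) (y : ℤ → ℕ) (k : ℕ) (θ : Param) :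
    limitLogLik f₁ (shift^[k] y) 1 θ = limitLogLik f₁ y (k + 1) θ := by
  rw [limitLogLik, limitLogLik, limitFilt_iterate_shift, shift_iterate_apply, add_comm]

theorem measurable_comp_natCast_path {F : ℕ → ℝ → ℝ} (hF : ∀ x, Measurable (F x)) (i : ℤ)
    {g : (ℤ → ℕ) → ℝ} (hg : Measurable g) : Measurable fun y : ℤ → ℕ => F (y i) (g y) :=
  (measurable_from_prod_countable_left (f := fun p : ℝ × ℕ => F p.2 p.1) hF).comp
    (hg.prodMk (measurable_pi_apply i))

theorem measurable_limitFilt {θ : Param} (hθ : θ ∈ admissible) (f₁ : Param → ℝ) (i : ℤ) :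
    Measurable fun y => limitFilt f₁ y i θ := by
  have hstep : ∀ x, Measurable (step θ x) := by
    intro x
    have := (differentiable_score hθ x).continuous
    unfold step
    fun_prop
  have hrun : ∀ (φ : ℕ → ℤ) (m : ℕ),
      Measurable fun y : ℤ → ℕ => run θ (fun j => y (φ j)) (f₁ θ) m := by
    intro φ m
    induction m with
    | zero => exact measurable_const
    | succ m ih => exact measurable_comp_natCast_path hstep _ ih
  exact (StronglyMeasurable.limUnder fun m : ℕ =>
    (hrun (fun j => i - m + j) m).stronglyMeasurable).measurable

theorem measurable_limitLogLik {θ : Param} (hθ : θ ∈ admissible) (f₁ : Param → ℝ) (i : ℤ) :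
    Measurable fun y => limitLogLik f₁ y i θ :=
  measurable_comp_natCast_path (F := logLik θ) (fun x => Continuous.measurable <|
    continuous_iff_continuousAt.2 fun f =>
      (hasDerivAt_logLik θ hθ.1 hθ.2.1 hθ.2.2 x f).continuousAt) i (measurable_limitFilt hθ f₁ i)

/-- The paths along which the filter is stable. -/
structure IsStablePath (Θ : Set Param) (y : ℤ → ℕ) : Prop where
  contraction_ne_top : ∀ j, contraction Θ (y j) ≠ ∞
  summable_past : ∀ k : ℕ, Summable (pastFactor Θ y (k + 1))
  summable_future : Summable fun k : ℕ =>
    (∏ j ∈ Finset.range k, (contraction Θ (y (j + 1))).toReal) * (1 + (y (k + 1) : ℝ))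

variable {ν : Measure (ℤ → ℕ)}

theorem ae_iterate_shift (hν : Ergodic shift ν) {p : (ℤ → ℕ) → Prop} (h : ∀ᵐ y ∂ν, p y) :
    ∀ᵐ y ∂ν, ∀ k : ℕ, p (shift^[k] y) :=
  ae_all_iff.2 fun k => (hν.toMeasurePreserving.iterate k).quasiMeasurePreserving.ae h

theorem ae_isStablePath [IsProbabilityMeasure ν] (hν : Ergodic shift ν) {Θ : Set Param}
    (hR : ∫⁻ y, logPos (contraction Θ (y 1)) ∂ν < ∫⁻ y, logNeg (contraction Θ (y 1)) ∂ν)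
    (hlog : Integrable (fun y : ℤ → ℕ => Real.log (1 + y 1)) ν) :
    ∀ᵐ y ∂ν, IsStablePath Θ y := by
  -- Orbits of the inverse shift run into the past, so one summability theorem serves both
  -- directions.
  have hν' : Ergodic shift.symm ν := hν.symm
  have hy : Measurable fun y : ℤ → ℕ => y 1 := measurable_pi_apply 1
  have hfin : ∀ᵐ y ∂ν, contraction Θ (y 1) ≠ ∞ := by
    filter_upwards [ae_lt_top ((measurable_from_top
      (f := fun n => logPos (contraction Θ n))).comp hy) hR.ne_top] with y h
    exact fun e => h.ne (logPos_eq_top_iff.2 e)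
  obtain ⟨g, hg, hneg, hle⟩ := exists_integrable_log_bound hy (contraction Θ) hR
  have hgm : Measurable fun y : ℤ → ℕ => g (y 1) := measurable_from_top.comp hy
  have hlm : Measurable fun y : ℤ → ℕ => Real.log (1 + y 1) :=
    (measurable_from_top (f := fun n : ℕ => Real.log (1 + n))).comp hy
  have hfut := hν.ae_summable_prod_mul_exp
    (r := fun y => (contraction Θ (y 1)).toReal) (fun _ => ENNReal.toReal_nonneg)
    (fun y => hle (y 1)) hgm hg hneg hlm hlog
  have hpast := hν'.ae_summable_prod_mul_exp
    (r := fun y => (contraction Θ (y 1)).toReal) (fun _ => ENNReal.toReal_nonneg)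
    (fun y => hle (y 1)) hgm hg hneg hlm hlog
  have hback : ∀ᵐ y ∂ν, ∀ k : ℕ, contraction Θ (shift.symm^[k] y 1) ≠ ∞ :=
    ae_all_iff.2 fun k => (hν'.toMeasurePreserving.iterate k).quasiMeasurePreserving.ae hfin
  filter_upwards [ae_iterate_shift hν hfin, hback, hfut, ae_iterate_shift hν
    (hν'.toMeasurePreserving.quasiMeasurePreserving.ae hpast)] with y h1 h2 h3 h4
  have hexp : ∀ n : ℕ, Real.exp (Real.log (1 + n)) = 1 + n :=
    fun n => Real.exp_log (by positivity)
  refine ⟨fun j => ?_, fun k => ?_, ?_⟩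
  · rcases le_total 1 j with hj | hj
    · have := h1 (j - 1).toNat
      rwa [shift_iterate_apply, Int.toNat_of_nonneg (by omega), add_sub_cancel] at this
    · have := h2 (1 - j).toNat
      rwa [shift_symm_iterate_apply, Int.toNat_of_nonneg (by omega), sub_sub_cancel] at this
  -- The extra inverse shift is needed because the factors behind time `k + 1` begin at time `k`.
  · have hi : ∀ n : ℕ, shift.symm^[n] (shift.symm (shift^[k] y)) 1 = y (k + 1 - 1 - n) := by
      intro n
      rw [shift_symm_iterate_apply, shift_symm_apply, shift_iterate_apply]
      congr 1
      ring
    have h := h4 k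
    simp only [hi, hexp] at h
    exact h
  · simpa only [shift_iterate_apply, hexp, add_comm (1 : ℤ)] using h3

end ZIACD

/-! ### One-sided uniform bounds and compactness. -/

namespace ZIACD

variable {ν : Measure (ℤ → ℕ)}

/-- The mean of the supremum of `ℓ₁` over a small ball about `θ` is close to that of `ℓ₁(θ)`. The
supremum is replaced with a measurable function that dominates it. -/
theorem exists_ball_dominating_lt {Θ : Set Param} (hΘ : Θ ⊆ admissible) (f₁ : Param → ℝ)
    (hcont : ∀ᵐ y ∂ν, ContinuousOn (limitLogLik f₁ y 1) Θ) {θ : Param} (hθ : θ ∈ Θ)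
    (hint : Integrable (fun y => limitLogLik f₁ y 1 θ) ν) {c : ℝ}
    (hc : ∫ y, limitLogLik f₁ y 1 θ ∂ν < c) :
    ∃ ε > 0, ∃ u : (ℤ → ℕ) → ℝ, Measurable u ∧ Integrable u ν ∧ ∫ y, u y ∂ν < c ∧
      ∀ᵐ y ∂ν, ∀ η ∈ Θ ∩ Metric.ball θ ε, limitLogLik f₁ y 1 η ≤ u y := by
  -- A supremum over a countable dense set is measurable; continuity in the parameter extends the
  -- domination to the rest of the ball in `Θ`.
  obtain ⟨D, hDΘ, hDc, hD⟩ :=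
    (TopologicalSpace.IsSeparable.of_separableSpace Θ).exists_countable_dense_subset
  have hnonpos : ∀ y, ∀ η ∈ Θ, limitLogLik f₁ y 1 η ≤ 0 :=
    fun y η hη => logLik_nonpos (hΘ hη) _ _
  set B : ℕ → Set Param := fun k => Metric.ball θ (1 / ((k : ℝ) + 1))
  set u : ℕ → (ℤ → ℕ) → ℝ := fun k y => ⨆ η : ↥(D ∩ B k), limitLogLik f₁ y 1 η
  have hclos : ∀ k, ∀ η ∈ Θ ∩ B k, η ∈ closure (D ∩ B k) := fun k η hη => by
    rw [Set.inter_comm]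
    exact Metric.isOpen_ball.inter_closure ⟨hη.2, hD hη.1⟩
  have hθB : ∀ k, θ ∈ Θ ∩ B k := fun k => ⟨hθ, Metric.mem_ball_self (by positivity)⟩
  have hne : ∀ k, Nonempty ↥(D ∩ B k) := fun k =>
    (closure_nonempty_iff.1 ⟨θ, hclos k θ (hθB k)⟩).to_subtype
  have hbdd : ∀ k y, BddAbove (Set.range fun η : ↥(D ∩ B k) => limitLogLik f₁ y 1 η) := by
    rintro k y
    refine ⟨0, ?_⟩
    rintro _ ⟨η, rfl⟩
    exact hnonpos y η (hDΘ η.2.1)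
  have hum : ∀ k, Measurable (u k) := by
    intro k
    have : Countable ↥(D ∩ B k) := (hDc.mono Set.inter_subset_left).to_subtype
    exact Measurable.iSup fun η => measurable_limitLogLik (hΘ (hDΘ η.2.1)) f₁ 1
  have hdom : ∀ᵐ y ∂ν, ∀ k, ∀ η ∈ Θ ∩ B k, limitLogLik f₁ y 1 η ≤ u k y := by
    filter_upwards [hcont] with y hy k η hη
    have : (𝓝[D ∩ B k] η).NeBot := mem_closure_iff_nhdsWithin_neBot.1 (hclos k η hη)
    have hsub : D ∩ B k ⊆ Θ := Set.inter_subset_left.trans hDΘ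
    refine le_of_tendsto ((hy η hη.1).mono hsub) ?_
    filter_upwards [self_mem_nhdsWithin] with ζ hζ
    exact le_ciSup (hbdd k y) ⟨ζ, hζ⟩
  have hu0 : ∀ k y, u k y ≤ 0 := fun k y => by
    have := hne k
    exact ciSup_le fun η => hnonpos y η (hDΘ η.2.1)
  have habs : ∀ k, ∀ᵐ y ∂ν, ‖u k y‖ ≤ |limitLogLik f₁ y 1 θ| := by
    intro k
    filter_upwards [hdom] with y hy
    rw [Real.norm_eq_abs, abs_of_nonpos (hu0 k y), abs_of_nonpos (hnonpos y θ hθ)]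
    exact neg_le_neg (hy k θ (hθB k))
  have hlim : Tendsto (fun k => ∫ y, u k y ∂ν) atTop (𝓝 (∫ y, limitLogLik f₁ y 1 θ ∂ν)) := by
    refine tendsto_integral_of_dominated_convergence _
      (fun k => (hum k).aestronglyMeasurable) hint.abs habs ?_
    filter_upwards [hcont, hdom] with y hy hyd
    refine tendsto_order.2 ⟨fun a ha => Eventually.of_forall fun k => ha.trans_le
      (hyd k θ (hθB k)), fun a ha => ?_⟩
    obtain ⟨b, hb, hba⟩ := exists_between ha
    obtain ⟨δ, hδ, hsub⟩ := Metric.mem_nhdsWithin_iff.1 ((hy θ hθ).eventually_lt_const hb)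
    obtain ⟨N, hN⟩ := exists_nat_one_div_lt hδ
    filter_upwards [eventually_ge_atTop N] with k hk
    have := hne k
    refine (ciSup_le fun η => ?_).trans_lt hba
    have hη : (η : Param) ∈ Metric.ball θ δ :=
      Metric.ball_subset_ball ((Nat.one_div_le_one_div hk).trans hN.le) η.2.2
    exact le_of_lt (hsub ⟨hη, hDΘ η.2.1⟩)
  obtain ⟨k, hk⟩ := ((tendsto_order.1 hlim).2 c hc).exists
  refine ⟨1 / ((k : ℝ) + 1), by positivity, u k, hum k,
    hint.abs.mono' (hum k).aestronglyMeasurable (habs k), hk, ?_⟩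
  filter_upwards [hdom] with y hy
  exact hy k

theorem sum_limitLogLik_eq_birkhoffSum (f₁ : Param → ℝ) (y : ℤ → ℕ) (θ : Param) (n : ℕ) :
    ∑ k ∈ Finset.range n, limitLogLik f₁ y (k + 1) θ =
      birkhoffSum shift (fun y => limitLogLik f₁ y 1 θ) n y :=
  Finset.sum_congr rfl fun k _ => (limitLogLik_iterate_shift f₁ y k θ).symm

/-- Near a parameter whose mean log-likelihood is not maximal, the sample log-likelihood is
eventually below its value at the maximizer. -/
theorem exists_ball_eventually_sampleLogLik_lt [IsProbabilityMeasure ν]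
    (hν : Ergodic shift ν) {Θ : Set Param}
    (hΘ : Θ ⊆ admissible) (hcomp : IsCompact Θ) {f₁ : Param → ℝ} (hf₁ : ContinuousOn f₁ Θ)
    (hstable : ∀ᵐ y ∂ν, IsStablePath Θ y) {θ θ₀ : Param} (hθ : θ ∈ Θ) (hθ₀ : θ₀ ∈ Θ)
    (hint : Integrable (fun y => limitLogLik f₁ y 1 θ) ν)
    (hint₀ : Integrable (fun y => limitLogLik f₁ y 1 θ₀) ν)
    (hlt : ∫ y, limitLogLik f₁ y 1 θ ∂ν < ∫ y, limitLogLik f₁ y 1 θ₀ ∂ν) :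
    ∃ ε > 0, ∀ᵐ y ∂ν, ∀ᶠ n : ℕ in atTop, ∀ η ∈ Θ ∩ Metric.ball θ ε,
      sampleLogLik f₁ y n η < sampleLogLik f₁ y n θ₀ := by
  -- Two levels: the ball stays below `c n` and `θ₀` above `d n`, and the gap `(d - c) n` outgrows
  -- the two filter errors, at most `E` each.
  obtain ⟨c, hc, hc₀⟩ := exists_between hlt
  obtain ⟨d, hcd, hd⟩ := exists_between hc₀
  have hcont : ∀ᵐ y ∂ν, ContinuousOn (limitLogLik f₁ y 1) Θ := by
    filter_upwards [hstable] with y hy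
    have h := hy.summable_past 0
    rw [Nat.cast_zero, zero_add] at h
    exact continuousOn_limitLogLik hΘ
      (limitFilt_spec hΘ hcomp hf₁ hy.contraction_ne_top h).2.2
  obtain ⟨ε, hε, u, hum, hui, huc, hu⟩ := exists_ball_dominating_lt hΘ f₁ hcont hθ hint hc
  refine ⟨ε, hε, ?_⟩
  filter_upwards [hν.ae_eventually_birkhoffSum_le hum hui huc,
    hν.ae_eventually_le_birkhoffSum (measurable_limitLogLik (hΘ hθ₀) f₁ 1) hint₀ hd,
    ae_iterate_shift hν hu, hstable] with y h1 h2 h3 h4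
  obtain ⟨E, hE⟩ := exists_abs_sum_logLik_sub_le hΘ hcomp hf₁ h4.contraction_ne_top
    h4.summable_past h4.summable_future
  obtain ⟨N, hN⟩ := exists_nat_gt (2 * E / (d - c))
  filter_upwards [h1, h2, eventually_ge_atTop N, eventually_gt_atTop 0] with n hn1 hn2 hNn hn0 η hη
  have e1 := abs_le.1 (hE η hη.1 n)
  have e2 := abs_le.1 (hE θ₀ hθ₀ n)
  rw [sum_limitLogLik_eq_birkhoffSum] at e1 e2
  have e3 : birkhoffSum shift (fun y => limitLogLik f₁ y 1 η) n y ≤ birkhoffSum shift u n y :=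
    Finset.sum_le_sum fun k _ => h3 k η hη
  have e4 : 2 * E < (d - c) * n := by
    rw [div_lt_iff₀' (sub_pos.2 hcd)] at hN
    have : (N : ℝ) ≤ n := by exact_mod_cast hNn
    nlinarith [sub_pos.2 hcd]
  have hn : (0 : ℝ) < (n : ℝ)⁻¹ := by positivity
  unfold sampleLogLik
  refine mul_lt_mul_of_pos_left ?_ hn
  linarith [e1.2, e2.1]

/-- The sample log-likelihood is eventually maximized only close to `θ₀`. -/
theorem ae_eventually_sampleLogLik_lt [IsProbabilityMeasure ν]
    (hν : Ergodic shift ν) {Θ : Set Param}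
    (hΘ : Θ ⊆ admissible) (hcomp : IsCompact Θ) {f₁ : Param → ℝ} (hf₁ : ContinuousOn f₁ Θ)
    (hstable : ∀ᵐ y ∂ν, IsStablePath Θ y) {θ₀ : Param} (hθ₀ : θ₀ ∈ Θ)
    (hint : ∀ θ ∈ Θ, Integrable (fun y => limitLogLik f₁ y 1 θ) ν)
    (hmax : ∀ θ ∈ Θ, θ ≠ θ₀ →
      ∫ y, limitLogLik f₁ y 1 θ ∂ν < ∫ y, limitLogLik f₁ y 1 θ₀ ∂ν) {r : ℝ} (hr : 0 < r) :
    ∀ᵐ y ∂ν, ∀ᶠ n : ℕ in atTop, ∀ θ ∈ Θ \ Metric.ball θ₀ r,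
      sampleLogLik f₁ y n θ < sampleLogLik f₁ y n θ₀ := by
  -- The property passes to subsets and finite unions, so compactness reduces it to small
  -- neighbourhoods.
  refine (hcomp.diff Metric.isOpen_ball).induction_on
    (p := fun s => ∀ᵐ y ∂ν, ∀ᶠ n : ℕ in atTop, ∀ θ ∈ s,
      sampleLogLik f₁ y n θ < sampleLogLik f₁ y n θ₀) (by simp) ?_ ?_ ?_
  · intro s t hst ht
    filter_upwards [ht] with y hy
    filter_upwards [hy] with n hn θ hθ using hn θ (hst hθ)
  · intro s t hs ht
    filter_upwards [hs, ht] with y hys hyt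
    filter_upwards [hys, hyt] with n hns hnt θ hθ using hθ.elim (hns θ) (hnt θ)
  · intro θ hθ
    have hne : θ ≠ θ₀ := fun h => hθ.2 (h ▸ Metric.mem_ball_self hr)
    obtain ⟨ε, hε, h⟩ := exists_ball_eventually_sampleLogLik_lt hν hΘ hcomp hf₁ hstable hθ.1 hθ₀
      (hint θ hθ.1) (hint θ₀ hθ₀) (hmax θ hθ.1 hne)
    refine ⟨Θ ∩ Metric.ball θ ε, ?_, h⟩
    exact mem_nhdsWithin_iff_exists_mem_nhds_inter.2 ⟨Metric.ball θ ε, Metric.ball_mem_nhds θ hε,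
      fun η hη => ⟨hη.2.1, hη.1⟩⟩

end ZIACD

/-! ### Transfer from path space to the data. -/

theorem lemma1 {Ω : Type*} [MeasurableSpace Ω] (μ : Measure Ω) [IsProbabilityMeasure μ]
    (x : ℤ → Ω → ℕ) (hx : ∀ i, Measurable (x i))
    (Θ : Set ZIACD.Param)
    (hΘ : ∀ θ ∈ Θ, 0 < θ.disp ∧ 0 ≤ θ.infl ∧ θ.infl < 1)
    (f₁ : ZIACD.Param → ℝ) (hf₁ : ContinuousOn f₁ Θ)
    (hinv : ZIACD.InvertibilityConditions μ x Θ f₁)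
    (hlik : ∀ θ ∈ Θ, Integrable (fun ω => ZIACD.limitLogLik f₁ (fun i => x i ω) 1 θ) μ)
    (hscore : ∀ θ ∈ Θ, ∫⁻ ω, ZIACD.logPos (⨆ f : ℝ, ‖ZIACD.score θ (x 1 ω) f‖ₑ) ∂μ < ∞)
    (θ₀ : ZIACD.Param) (hθ₀ : θ₀ ∈ Θ)
    (hmax : ∀ θ ∈ Θ, θ ≠ θ₀ →
      ∫ ω, ZIACD.limitLogLik f₁ (fun i => x i ω) 1 θ ∂μ
        < ∫ ω, ZIACD.limitLogLik f₁ (fun i => x i ω) 1 θ₀ ∂μ)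
    (θhat : ℕ → Ω → ZIACD.Param)
    (hhat : ∀ n, 1 ≤ n → ∀ᵐ ω ∂μ, θhat n ω ∈ Θ ∧
      IsMaxOn (ZIACD.sampleLogLik f₁ (fun i => x i ω) n) Θ (θhat n ω)) :
    ∀ᵐ ω ∂μ, Tendsto (fun n => θhat n ω) atTop (𝓝 θ₀) := by
  have hφ : Measurable fun ω i => x i ω := measurable_pi_lambda _ hx
  set ν := μ.map (fun ω i => x i ω)
  have : IsProbabilityMeasure ν := Measure.isProbabilityMeasure_map hφ.aemeasurable
  have hν : Ergodic ZIACD.shift ν := hinv.stationary_ergodic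
  have hlint : ∀ F : ℕ → ℝ≥0∞, ∫⁻ y, F (y 1) ∂ν = ∫⁻ ω, F (x 1 ω) ∂μ := fun F =>
    lintegral_map (measurable_from_top.comp (measurable_pi_apply 1)) hφ
  have hlm : Measurable fun y : ℤ → ℕ => y 1 := measurable_pi_apply 1
  have hstable : ∀ᵐ y ∂ν, ZIACD.IsStablePath Θ y := by
    refine ZIACD.ae_isStablePath hν ?_ ?_
    · have h := hinv.contracting
      have e := ZIACD.measure_zero_mul_add_measure_pos_mul (μ := μ) (hx 1)
      rw [e fun n => ZIACD.logPos (ZIACD.contraction Θ n),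
        e fun n => ZIACD.logNeg (ZIACD.contraction Θ n)] at h
      rwa [hlint fun n => ZIACD.logPos (ZIACD.contraction Θ n),
        hlint fun n => ZIACD.logNeg (ZIACD.contraction Θ n)]
    · refine ZIACD.integrable_log_one_add (θ := θ₀) hlm ?_
      rw [hlint fun n => ZIACD.logPos (⨆ f : ℝ, ‖ZIACD.score θ₀ n f‖ₑ)]
      exact hscore θ₀ hθ₀
  have hmeas : ∀ θ ∈ Θ, AEStronglyMeasurable (fun y => ZIACD.limitLogLik f₁ y 1 θ) ν :=
    fun θ hθ => (ZIACD.measurable_limitLogLik (hΘ θ hθ) f₁ 1).aestronglyMeasurable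
  have hint : ∀ θ ∈ Θ, Integrable (fun y => ZIACD.limitLogLik f₁ y 1 θ) ν := fun θ hθ =>
    (integrable_map_measure (hmeas θ hθ) hφ.aemeasurable).2 (hlik θ hθ)
  have hmaxν : ∀ θ ∈ Θ, θ ≠ θ₀ →
      ∫ y, ZIACD.limitLogLik f₁ y 1 θ ∂ν < ∫ y, ZIACD.limitLogLik f₁ y 1 θ₀ ∂ν := by
    intro θ hθ hne
    rw [integral_map hφ.aemeasurable (hmeas θ hθ), integral_map hφ.aemeasurable (hmeas θ₀ hθ₀)]
    exact hmax θ hθ hne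
  -- Countably many radii, so that one null set serves all neighbourhoods of `θ₀`.
  have hsep : ∀ᵐ ω ∂μ, ∀ k : ℕ, ∀ᶠ n : ℕ in atTop, ∀ θ ∈ Θ \ Metric.ball θ₀ (1 / ((k : ℝ) + 1)),
      ZIACD.sampleLogLik f₁ (fun i => x i ω) n θ <
        ZIACD.sampleLogLik f₁ (fun i => x i ω) n θ₀ :=
    ae_all_iff.2 fun k => ae_of_ae_map hφ.aemeasurable
      (ZIACD.ae_eventually_sampleLogLik_lt hν hΘ hinv.compact hf₁ hstable hθ₀ hint hmaxν
        (by positivity))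
  have hhat' : ∀ᵐ ω ∂μ, ∀ n, 1 ≤ n → θhat n ω ∈ Θ ∧
      IsMaxOn (ZIACD.sampleLogLik f₁ (fun i => x i ω) n) Θ (θhat n ω) :=
    ae_all_iff.2 fun n => by
      by_cases h : 1 ≤ n
      · filter_upwards [hhat n h] with ω hω _ using hω
      · exact ae_of_all _ fun _ h' => absurd h' h
  filter_upwards [hsep, hhat'] with ω h1 h2
  rw [Metric.tendsto_nhds]
  intro ε hε
  obtain ⟨k, hk⟩ := exists_nat_one_div_lt hε
  filter_upwards [h1 k, eventually_ge_atTop 1] with n hn hn1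
  obtain ⟨hmem, hM⟩ := h2 n hn1
  by_contra hfar
  -- A maximizer far from `θ₀` would have a strictly smaller likelihood than `θ₀`.
  exact (hn (θhat n ω) ⟨hmem, fun hb => hfar ((Metric.mem_ball.1 hb).trans hk)⟩).not_ge (hM hθ₀)
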